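/- Let $p\neq 1$ be an integer and put $\hat I=(-\infty,-2)$ if $p>1$ is odd, $\hat I=(0,+\infty)$ if $p<1$ is odd, and $\hat I=(-\infty,-2)\cup(0,+\infty)$ if $p$ is even. Let $m\ge 1$ be an integer and $\beta\in\mathbb R\setminus\{0,1,2\}$. For $y<0$ the power $y^\beta$ is understood as $\sigma|y|^\beta$ with a fixed branch $\sigma\in\{1,-1\}$ (the usual power for an integer $\beta$ is $\sigma=(-1)^\beta$). With $E=[0,\pi]$ set $$\mathcal C_k^E(\rho,\beta)=\int_E\cos(k\theta)\,(1+\rho-\cos\theta)^\beta\,d\theta,\qquad \mathcal S_k^E(\rho,\beta)=\int_E\sin(k\theta)\,(1+\rho-\cos\theta)^\beta\,d\theta .$$ Then the ordered set of $4m+2$ functions of $\rho$ $$\bigl(1,\ \rho^\beta,\ (\rho+2)^\beta,\ \mathcal C_0^E(\rho,\beta),\dots,\mathcal C_{2m-1}^E(\rho,\beta),\ \mathcal S_{2m-1}^E(\rho,\beta),\dots,\mathcal S_1^E(\rho,\beta)\bigr)$$ is an ECT-system (extended complete Chebyshev system) on every nonempty open interval $J\subseteq\hat I$ (thus on $\hat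 I$ itself when $p$ is odd, and on each of its two components when $p$ is even): all these functions are analytic on $J$ and, for every $k=1,\dots,4m+2$, every linear combination of the first $k$ of them whose coefficients are not all zero has at most $k-1$ isolated zeros on $J$, counted with multiplicity. If moreover $\beta$ is not a non-negative integer, then the $4m+2$ functions are linearly independent on $J$, so that no such linear combination vanishes identically on $J$. -/

import Mathlib

open Set Filter Topology MeasureTheory

noncomputable section

/-- The real power `y ^ β` of a nonzero real number `y`. For `y > 0` it is the usual one; for
`y < 0` it is `σ * |y| ^ β`, where `σ = 1` or `σ = -1` is the chosen real branch
(for an integer `β` the usual power is the branch `σ = (-1) ^ β`). -/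
def branchPow (σ y β : ℝ) : ℝ :=
  if y < 0 then σ * |y| ^ β else y ^ β

/-- `𝒞_k^E(ρ, β) = ∫_E cos (k θ) (1 + ρ - cos θ) ^ β dθ`. -/
def cosIntegral (σ : ℝ) (E : Set ℝ) (k : ℕ) (β ρ : ℝ) : ℝ :=
  ∫ θ in E, Real.cos (k * θ) * branchPow σ (1 + ρ - Real.cos θ) β

/-- `𝒮_k^E(ρ, β) = ∫_E sin (k θ) (1 + ρ - cos θ) ^ β dθ`. -/
def sinIntegral (σ : ℝ) (E : Set ℝ) (k : ℕ) (β ρ : ℝ) : ℝ :=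
  ∫ θ in E, Real.sin (k * θ) * branchPow σ (1 + ρ - Real.cos θ) β

/-- The set `Î` of the parameters `ρ`, for an integer `p ≠ 1`. -/
def annulusParams (p : ℤ) : Set ℝ :=
  if Even p then Iio (-2) ∪ Ioi 0
  else if 1 < p then Iio (-2)
  else Ioi 0

/-- `x` is an isolated zero of `F`. -/
def IsIsolatedZero (F : ℝ → ℝ) (x : ℝ) : Prop :=
  F x = 0 ∧ ∀ᶠ y in 𝓝[≠] x, F y ≠ 0

/-- `F` has at most `N` isolated zeros on `J`, counted with multiplicity. For an analytic `F` the
multiplicity of a zero is its order of vanishing `analyticOrderAt F x`, which is finite and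
positive at an isolated zero. -/
def AtMostIsolatedZeros (F : ℝ → ℝ) (J : Set ℝ) (N : ℕ) : Prop :=
  ∀ Z : Finset ℝ, (∀ x ∈ Z, x ∈ J ∧ IsIsolatedZero F x) →
    ∑ x ∈ Z, analyticOrderAt F x ≤ (N : ℕ∞)

/-- `(f 0, …, f (n - 1))` is an extended complete Chebyshev system on the open interval `J`:
the functions are analytic on `J` and, for `k = 1, …, n`, every nontrivial linear combination of
`f 0, …, f (k - 1)` has at most `k - 1` isolated zeros on `J`, counted with multiplicity. -/
def IsECTSystem {n : ℕ} (f : Fin n → ℝ → ℝ) (J : Set ℝ) : Prop :=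
  (∀ i, AnalyticOnNhd ℝ (f i) J) ∧
  ∀ (k : ℕ) (_ : 1 ≤ k) (hk : k ≤ n) (a : Fin k → ℝ), a ≠ 0 →
    AtMostIsolatedZeros (fun x => ∑ i, a i * f (Fin.castLE hk i) x) J (k - 1)

/-- With `E = [0, π]`, the ordered set of functions of `ρ`
`(1, ρ ^ β, (ρ + 2) ^ β, 𝒞_0^E, …, 𝒞_{2m-1}^E, 𝒮_{2m-1}^E, …, 𝒮_1^E)`. -/
def chebyshevList (σ β : ℝ) (m : ℕ) : List (ℝ → ℝ) :=
  [fun _ => 1, fun ρ => branchPow σ ρ β, fun ρ => branchPow σ (ρ + 2) β] ++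
    (List.range (2 * m)).map (fun k => cosIntegral σ (Icc 0 Real.pi) k β) ++
    ((List.range (2 * m - 1)).reverse).map
      (fun j => sinIntegral σ (Icc 0 Real.pi) (j + 1) β)

end

/-! Put `x = 1 + ρ` and `u = cos θ`. On an interval where `ε (x - u) > 0` for all `u ∈ [-1, 1]`,
with `ε = ±1`, a combination with coefficients `c` becomes `c 0 + τ ∫ h(u) (ε (x - u)) ^ β dμ(u)`.
Here `μ` (`cosMeasure`) is the image of Lebesgue measure under the cosine plus unit masses at `±1`.
These masses carry `ρ ^ β` and `(ρ + 2) ^ β`, and inside `(-1, 1)` the density `h` is a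
trigonometric polynomial in `arccos u`.

One derivative removes `c 0`. The remaining transform is variation diminishing: it has at most as
many zeros as `h` has sign changes (`atMostIsolatedZeros_powTransform`). To remove a sign change at
`v`, divide by `(ε (x - v)) ^ β` and differentiate. Up to a nonvanishing factor this replaces `h` by
`(u - v) h` and `β` by `β - 1`, and by Rolle it costs one zero. When no sign change is left, the
integral vanishes only if `h` does almost everywhere.

It remains to count sign changes. The trigonometric part of the first `k` functions has at most `k -
4` zeros in `(-1, 1)` (`atMostIsolatedZeros_chebyshevTrigPoly`): enough derivatives in `u` kill the
cosine polynomial and turn the sine part into a power of `1 - u ^ 2` times a polynomial of low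
degree. The points `±1` add two sign changes and `c 0` adds one zero, which gives `k - 1`.

For independence, the same elimination runs on a vanishing combination. If `β` is not a non-negative
integer, none of the factors `β - j` vanishes, so `h` is zero off a finite set, and its coefficients
can be read off. -/

/-! ### Counting isolated zeros with multiplicity, and Rolle's theorem. -/

lemma isIsolatedZero_iff {f : ℝ → ℝ} {x : ℝ} (hf : AnalyticAt ℝ f x) :
    IsIsolatedZero f x ↔ f x = 0 ∧ analyticOrderAt f x ≠ ⊤ := by
  unfold IsIsolatedZero
  refine and_congr_right fun _ => ?_
  rw [Ne, analyticOrderAt_eq_top]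
  rcases hf.eventually_eq_zero_or_eventually_ne_zero with h | h
  · refine iff_of_false (fun h' => ?_) (fun h' => h' h)
    obtain ⟨y, hy⟩ := (h'.and (h.filter_mono nhdsWithin_le_nhds)).exists
    exact hy.1 hy.2
  · refine iff_of_true h fun h' => ?_
    obtain ⟨y, hy⟩ := (h.and (h'.filter_mono nhdsWithin_le_nhds)).exists
    exact hy.1 hy.2

lemma IsIsolatedZero.congr {f g : ℝ → ℝ} {x : ℝ} (h : f =ᶠ[𝓝 x] g) (hf : IsIsolatedZero f x) :
    IsIsolatedZero g x := by
  refine ⟨h.eq_of_nhds ▸ hf.1, ?_⟩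
  filter_upwards [hf.2, h.filter_mono nhdsWithin_le_nhds] with y hy hy'
  rwa [← hy']

namespace AtMostIsolatedZeros

variable {f g : ℝ → ℝ} {J : Set ℝ} {N M : ℕ}

lemma mono (h : AtMostIsolatedZeros f J N) (hNM : N ≤ M) : AtMostIsolatedZeros f J M :=
  fun Z hZ => (h Z hZ).trans (by exact_mod_cast hNM)

lemma congr (hJ : IsOpen J) (hfg : EqOn f g J) (h : AtMostIsolatedZeros f J N) :
    AtMostIsolatedZeros g J N := by
  intro Z hZ
  have he : ∀ x ∈ Z, g =ᶠ[𝓝 x] f := fun x hx =>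
    (eventuallyEq_of_mem (hJ.mem_nhds (hZ x hx).1) hfg).symm
  calc ∑ x ∈ Z, analyticOrderAt g x = ∑ x ∈ Z, analyticOrderAt f x :=
        Finset.sum_congr rfl fun x hx => analyticOrderAt_congr (he x hx)
    _ ≤ N := h Z fun x hx => ⟨(hZ x hx).1, (hZ x hx).2.congr (he x hx)⟩

lemma of_forall_not (h : ∀ x ∈ J, ¬ IsIsolatedZero f x) : AtMostIsolatedZeros f J N := by
  intro Z hZ
  have : Z = ∅ := Finset.eq_empty_of_forall_notMem fun x hx => h x (hZ x hx).1 (hZ x hx).2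
  simp [this]

lemma of_eqOn_zero (hJ : IsOpen J) (h : ∀ x ∈ J, f x = 0) : AtMostIsolatedZeros f J N := by
  refine of_forall_not fun x hx hx' => ?_
  obtain ⟨y, hy⟩ := (hx'.2.and
    ((hJ.eventually_mem hx).filter_mono nhdsWithin_le_nhds)).exists
  exact hy.1 (h y hy.2)

/-- For functions that vanish identically or nowhere: an identically zero function has no isolated
zero, so every bound holds. -/
lemma of_zero_imp (hJ : IsOpen J) (h : ∀ x ∈ J, f x = 0 → ∀ y ∈ J, f y = 0) :
    AtMostIsolatedZeros f J N := by
  by_cases h' : ∃ x ∈ J, f x = 0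
  · obtain ⟨x, hx, hfx⟩ := h'
    exact of_eqOn_zero hJ (h x hx hfx)
  · exact of_forall_not fun x hx hx' => h' ⟨x, hx, hx'.1⟩

/-- Multiplication by a nowhere vanishing analytic function does not change the zeros. -/
lemma mul_left (hf : AnalyticOnNhd ℝ f J) (hg : AnalyticOnNhd ℝ g J) (hg0 : ∀ x ∈ J, g x ≠ 0)
    (h : AtMostIsolatedZeros f J N) : AtMostIsolatedZeros (g * f) J N := by
  intro Z hZ
  have ho : ∀ x ∈ J, analyticOrderAt (g * f) x = analyticOrderAt f x := fun x hx => by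
    rw [analyticOrderAt_mul (hg x hx) (hf x hx), ((hg x hx).analyticOrderAt_eq_zero).2 (hg0 x hx),
      zero_add]
  rw [Finset.sum_congr rfl fun x hx => ho x (hZ x hx).1]
  refine h Z fun x hx => ⟨(hZ x hx).1, ?_⟩
  have hxJ := (hZ x hx).1
  have := (isIsolatedZero_iff ((hg x hxJ).mul (hf x hxJ))).1 (hZ x hx).2
  rw [ho x hxJ] at this
  refine (isIsolatedZero_iff (hf x hxJ)).2 ⟨?_, this.2⟩
  simpa [hg0 x hxJ] using this.1

lemma of_mul_left (hf : AnalyticOnNhd ℝ f J) (hg : AnalyticOnNhd ℝ g J) (hg0 : ∀ x ∈ J, g x ≠ 0)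
    (hJ : IsOpen J) (h : AtMostIsolatedZeros (g * f) J N) : AtMostIsolatedZeros f J N := by
  have h1 := h.mul_left (hg.mul hf) (hg.inv hg0) (fun x hx => inv_ne_zero (hg0 x hx))
  refine h1.congr hJ fun x hx => ?_
  simp [hg0 x hx]

/-- Rolle's theorem, counting multiplicities. -/
theorem of_deriv (hJc : J.OrdConnected) (hf : AnalyticOnNhd ℝ f J)
    (h : AtMostIsolatedZeros (deriv f) J N) : AtMostIsolatedZeros f J (N + 1) := by
  classical
  intro Z hZ
  rcases Z.eq_empty_or_nonempty with rfl | ⟨x₀, hx₀⟩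
  · simp
  have hiso : ∀ x ∈ Z, f x = 0 ∧ analyticOrderAt f x ≠ ⊤ := fun x hx =>
    (isIsolatedZero_iff (hf x (hZ x hx).1)).1 (hZ x hx).2
  have hord : ∀ x ∈ Z, analyticOrderAt (deriv f) x + 1 = analyticOrderAt f x := fun x hx => by
    simpa [(hiso x hx).1] using (hf x (hZ x hx).1).analyticOrderAt_deriv_add_one
  -- An isolated zero of `f` forces finite order of `f'` there, and finiteness spreads over the
  -- connected set `J`; so every zero of `f'` is isolated.
  have hfin : ∀ x ∈ J, analyticOrderAt (deriv f) x ≠ ⊤ := by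
    have h0 : analyticOrderAt (deriv f) x₀ ≠ ⊤ := fun h0 => by
      have := hord x₀ hx₀
      rw [h0] at this
      exact (hiso x₀ hx₀).2 (by rw [← this]; rfl)
    exact fun x hx => hf.deriv.analyticOrderAt_ne_top_of_isPreconnected hJc.isPreconnected
      (hZ x₀ hx₀).1 hx h0
  have hrolle : ∀ x ∈ Z, ∀ y ∈ Z, x < y → ∃ z, z ∈ Ioo x y ∧ deriv f z = 0 := by
    intro x hx y hy hxy
    refine exists_deriv_eq_zero hxy ?_ ((hiso x hx).1.trans (hiso y hy).1.symm)
    exact fun z hz => (hf z (hJc.out (hZ x hx).1 (hZ y hy).1 hz)).continuousAt.continuousWithinAt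
  choose! c hc using hrolle
  set t : Finset ℝ := ((Z ×ˢ Z).filter fun q => q.1 < q.2).image fun q => c q.1 q.2 with ht
  have htmem : ∀ z ∈ t, z ∈ J ∧ deriv f z = 0 := by
    intro z hz
    obtain ⟨q, hq, rfl⟩ := Finset.mem_image.1 hz
    rw [Finset.mem_filter, Finset.mem_product] at hq
    have := hc _ hq.1.1 _ hq.1.2 hq.2
    exact ⟨hJc.out (hZ _ hq.1.1).1 (hZ _ hq.1.2).1 (Ioo_subset_Icc_self this.1), this.2⟩
  -- A Rolle point between consecutive points of `Z` lies outside `Z`, so there are at least `Z.card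
  -- - 1` new ones.
  have hcard : Z.card ≤ (t \ Z).card + 1 := by
    refine Finset.card_le_sdiff_of_interleaved fun x hx y hy hxy _ => ?_
    refine ⟨c x y, ?_, (hc x hx y hy hxy).1⟩
    exact Finset.mem_image.2 ⟨(x, y), by simp [hx, hy, hxy], rfl⟩
  have hone : ∀ z ∈ t, 1 ≤ analyticOrderAt (deriv f) z := fun z hz => by
    rw [Order.one_le_iff_ne_zero]
    exact ((hf.deriv z (htmem z hz).1).analyticOrderAt_ne_zero).2 (htmem z hz).2
  -- Zeros of `f'` from two disjoint sources: multiple zeros of `f`, with order lowered by one, and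
  -- new Rolle points.
  set W : Finset ℝ := Z.filter (fun x => deriv f x = 0) ∪ t \ Z with hW
  have hWle := h W (by
    intro x hx
    rw [hW, Finset.mem_union, Finset.mem_filter, Finset.mem_sdiff] at hx
    have hx' : x ∈ J ∧ deriv f x = 0 := by
      rcases hx with hx | hx
      · exact ⟨(hZ x hx.1).1, hx.2⟩
      · exact htmem x hx.1
    exact ⟨hx'.1, (isIsolatedZero_iff (hf.deriv x hx'.1)).2 ⟨hx'.2, hfin x hx'.1⟩⟩)
  have hdisj : Disjoint (Z.filter fun x => deriv f x = 0) (t \ Z) :=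
    Finset.disjoint_left.2 fun x hx hx' =>
      (Finset.mem_sdiff.1 hx').2 (Finset.mem_filter.1 hx).1
  rw [hW, Finset.sum_union hdisj] at hWle
  have hsum : ∑ x ∈ Z.filter (fun x => deriv f x = 0), analyticOrderAt (deriv f) x
      = ∑ x ∈ Z, analyticOrderAt (deriv f) x := by
    refine Finset.sum_subset (Finset.filter_subset _ _) fun x hx hx' => ?_
    rw [Finset.mem_filter, not_and] at hx'
    exact ((hf.deriv x (hZ x hx).1).analyticOrderAt_eq_zero).2 (hx' hx)
  rw [hsum] at hWle
  have hcard2 : ((t \ Z).card : ℕ∞) ≤ ∑ x ∈ t \ Z, analyticOrderAt (deriv f) x := by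
    rw [Finset.card_eq_sum_ones, Nat.cast_sum]
    exact Finset.sum_le_sum fun x hx => by
      simpa using hone x (Finset.mem_sdiff.1 hx).1
  calc ∑ x ∈ Z, analyticOrderAt f x = ∑ x ∈ Z, (analyticOrderAt (deriv f) x + 1) :=
        Finset.sum_congr rfl fun x hx => (hord x hx).symm
    _ = ∑ x ∈ Z, analyticOrderAt (deriv f) x + (Z.card : ℕ∞) := by
        rw [Finset.sum_add_distrib]; simp
    _ ≤ ∑ x ∈ Z, analyticOrderAt (deriv f) x + (((t \ Z).card : ℕ∞) + 1) := by
        gcongr; exact_mod_cast hcard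
    _ ≤ ∑ x ∈ Z, analyticOrderAt (deriv f) x +
        (∑ x ∈ t \ Z, analyticOrderAt (deriv f) x + 1) := by gcongr
    _ ≤ ((N + 1 : ℕ) : ℕ∞) := by
        rw [← add_assoc]; push_cast; gcongr

end AtMostIsolatedZeros

/-! ### Sign changes of an analytic function. -/

lemma AnalyticAt.dslope {f : ℝ → ℝ} {a x : ℝ} (hf : AnalyticAt ℝ f x) :
    AnalyticAt ℝ (dslope f a) x := by
  rcases eq_or_ne x a with rfl | hx
  · obtain ⟨p, hp⟩ := hf
    exact hp.has_fpower_series_dslope_fslope.analyticAt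
  · have h1 : AnalyticAt ℝ (fun b => (b - a)⁻¹ * (f b - f a)) x :=
      ((analyticAt_id.sub analyticAt_const).inv (sub_ne_zero.2 hx)).mul (hf.sub analyticAt_const)
    refine h1.congr ?_
    filter_upwards [isOpen_ne.mem_nhds hx] with y hy
    rw [dslope_of_ne _ hy, slope_def_field]
    field_simp

/-- An analytic function with at most `N` isolated zeros, multiplied by a suitable product of at
most `N` linear factors, has no sign change. -/
theorem AtMostIsolatedZeros.exists_list_sign {J : Set ℝ} (hJc : J.OrdConnected)
    {N : ℕ} : ∀ {h : ℝ → ℝ}, AnalyticOnNhd ℝ h J → AtMostIsolatedZeros h J N →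
    ∃ (l : List ℝ) (s : ℝ), l.length ≤ N ∧ (∀ v ∈ l, v ∈ J) ∧ s ≠ 0 ∧
      ∀ u ∈ J, 0 ≤ s * (h u * (l.map fun v => u - v).prod) := by
  have aux : ∀ (h : ℝ → ℝ), AnalyticOnNhd ℝ h J → (∀ u ∈ J, h u ≠ 0) →
      ∃ s : ℝ, s ≠ 0 ∧ ∀ u ∈ J, 0 ≤ s * h u := by
    intro h hh h0
    have hcont : ContinuousOn h J := hh.continuousOn
    by_cases hneg : ∃ a ∈ J, h a < 0
    · obtain ⟨a, ha, hha⟩ := hneg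
      refine ⟨-1, by norm_num, fun u hu => ?_⟩
      by_contra! hlt
      have : (0 : ℝ) ∈ h '' J := hJc.isPreconnected.intermediate_value ha hu hcont
        ⟨hha.le, by linarith⟩
      obtain ⟨z, hz, hz0⟩ := this
      exact h0 z hz hz0
    · push Not at hneg
      exact ⟨1, one_ne_zero, fun u hu => by simpa using hneg u hu⟩
  induction N with
  | zero =>
    intro h hh hN
    by_cases hz : ∃ x ∈ J, analyticOrderAt h x = ⊤
    · obtain ⟨x, hx, hx'⟩ := hz
      have h0 : ∀ y ∈ J, h y = 0 := fun y hy => by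
        have : analyticOrderAt h y = ⊤ := by
          by_contra hne
          exact hh.analyticOrderAt_ne_top_of_isPreconnected hJc.isPreconnected hy hx hne hx'
        exact (analyticOrderAt_eq_top.1 this).self_of_nhds
      exact ⟨[], 1, by simp, by simp, one_ne_zero, fun u hu => by simp [h0 u hu]⟩
    · push Not at hz
      obtain ⟨s, hs, hs'⟩ := aux h hh fun u hu hu0 => by
        have := hN {u} (by simpa using ⟨hu, (isIsolatedZero_iff (hh u hu)).2 ⟨hu0, hz u hu⟩⟩)
        simp only [Finset.sum_singleton, Nat.cast_zero, nonpos_iff_eq_zero] at this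
        exact ((hh u hu).analyticOrderAt_eq_zero.1 this) hu0
      exact ⟨[], s, by simp, by simp, hs, fun u hu => by simpa using hs' u hu⟩
  | succ N ih =>
    intro h hh hN
    by_cases hz : ∃ x ∈ J, IsIsolatedZero h x
    swap
    · push Not at hz
      obtain ⟨l, s, hl, h'⟩ := ih hh (AtMostIsolatedZeros.of_forall_not hz)
      exact ⟨l, s, hl.trans (Nat.le_succ _), h'⟩
    obtain ⟨a, ha, hza⟩ := hz
    -- Factor out one zero: the quotient `dslope h a` stays analytic and has one zero fewer, because
    -- `u - a` has order one at `a`.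
    have hq : AnalyticOnNhd ℝ (dslope h a) J := fun x hx => (hh x hx).dslope
    have hfac : h = (fun x => x - a) * dslope h a := by
      ext x
      have := sub_smul_dslope h a x
      simpa [hza.1] using this.symm
    have hord : ∀ x ∈ J, analyticOrderAt h x
        = analyticOrderAt (fun x => x - a) x + analyticOrderAt (dslope h a) x := fun x hx => by
      conv_lhs => rw [hfac]
      exact analyticOrderAt_mul (analyticAt_id.sub analyticAt_const) (hq x hx)
    have hqN : AtMostIsolatedZeros (dslope h a) J N := by
      classical
      intro Z hZ
      have hfin : ∀ x ∈ J, analyticOrderAt h x ≠ ⊤ := fun x hx =>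
        hh.analyticOrderAt_ne_top_of_isPreconnected hJc.isPreconnected ha hx
          ((isIsolatedZero_iff (hh a ha)).1 hza).2
      have hins := hN (insert a Z) (by
        intro x hx
        rcases Finset.mem_insert.1 hx with rfl | hx
        · exact ⟨ha, hza⟩
        · have hxJ := (hZ x hx).1
          refine ⟨hxJ, (isIsolatedZero_iff (hh x hxJ)).2 ⟨?_, hfin x hxJ⟩⟩
          rw [hfac]
          simp [(hZ x hx).2.1])
      have hle : ∑ x ∈ Z, analyticOrderAt (dslope h a) x + 1
          ≤ ∑ x ∈ insert a Z, analyticOrderAt h x := by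
        calc ∑ x ∈ Z, analyticOrderAt (dslope h a) x + 1
            ≤ ∑ x ∈ insert a Z, analyticOrderAt (dslope h a) x
              + ∑ x ∈ insert a Z, analyticOrderAt (fun x => x - a) x := by
              refine add_le_add ?_ ?_
              · exact Finset.sum_le_sum_of_subset (Finset.subset_insert a Z)
              · refine le_trans (le_of_eq ?_) (Finset.single_le_sum
                  (f := fun x => analyticOrderAt (fun x => x - a) x)
                  (fun _ _ => zero_le) (Finset.mem_insert_self (α := ℝ) a Z))
                exact analyticOrderAt_id_sub_const_self.symm
          _ = ∑ x ∈ insert a Z, analyticOrderAt h x := by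
              rw [← Finset.sum_add_distrib]
              refine Finset.sum_congr rfl fun x hx => ?_
              rw [hord x, add_comm]
              rcases Finset.mem_insert.1 hx with rfl | hx
              · exact ha
              · exact (hZ x hx).1
      have := hle.trans hins
      rw [Nat.cast_add, Nat.cast_one] at this
      exact (ENat.add_le_add_iff_right (by simp)).1 this
    obtain ⟨l, s, hl, hlJ, hs, hsign⟩ := ih hq hqN
    refine ⟨a :: l, s, by simpa using hl, by simpa using ⟨ha, hlJ⟩, hs, fun u hu => ?_⟩
    -- `h u * (u - a)` is `(u - a) ^ 2` times the quotient, so the linear factor for `a` undoes the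
    -- sign change.
    have h1 := mul_nonneg (sq_nonneg (u - a)) (hsign u hu)
    have h2 : h u = (u - a) * dslope h a u := congrFun hfac u
    rw [h2, List.map_cons, List.prod_cons]
    linarith

/-! ### The power transform: analyticity and variation diminishing. -/

noncomputable section

/-- The transform `x ↦ ∫ h(u) (ε (x - u)) ^ β dμ(u)`. -/
def powTransform (ε : ℝ) (μ : Measure ℝ) (β : ℝ) (h : ℝ → ℝ) (x : ℝ) : ℝ :=
  ∫ u, h u * (ε * (x - u)) ^ β ∂μ

/-- The points `x` such that `ε (x - u)` is positive for all `u ∈ [-1, 1]`. -/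
def powDomain (ε : ℝ) : Set ℝ := {x | ∀ u ∈ Icc (-1 : ℝ) 1, 0 < ε * (x - u)}

lemma isOpen_powDomain (ε : ℝ) : IsOpen (powDomain ε) := by
  have : powDomain ε = {x | 0 < ε * (x - 1)} ∩ {x | 0 < ε * (x - -1)} := by
    ext x
    refine ⟨fun hx => ⟨hx 1 (by norm_num), hx (-1) (by norm_num)⟩, fun hx u hu => ?_⟩
    have h1 : 0 < ε * (x - 1) := hx.1
    have h2 : 0 < ε * (x - -1) := hx.2
    have : ε * (x - u) = ((1 + u) * (ε * (x - 1)) + (1 - u) * (ε * (x - -1))) / 2 := by ring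
    rw [this]
    rcases hu.1.eq_or_lt with rfl | hu'
    · linarith
    · have := mul_pos (by linarith : 0 < 1 + u) h1
      have := mul_nonneg (by linarith [hu.2] : 0 ≤ 1 - u) h2.le
      linarith
  rw [this]
  exact (isOpen_lt continuous_const (by fun_prop)).inter (isOpen_lt continuous_const (by fun_prop))

lemma Real.rpow_le_rpow_add_rpow {a b t : ℝ} (ha : 0 < a) (hat : a ≤ t) (htb : t ≤ b) (γ : ℝ) :
    t ^ γ ≤ a ^ γ + b ^ γ := by
  have hb : 0 < b := ha.trans_le (hat.trans htb)
  rcases le_total 0 γ with h | h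
  · have := Real.rpow_le_rpow (ha.le.trans hat) htb h
    have := Real.rpow_nonneg ha.le γ
    linarith
  · have := Real.rpow_le_rpow_of_nonpos ha hat h
    have := Real.rpow_nonneg hb.le γ
    linarith

variable {ε : ℝ} {μ : Measure ℝ} {h : ℝ → ℝ} {J : Set ℝ}

/-- The radius is half the minimum of `ε (x₀ - u)` over `[-1, 1]`; moving `x₀` by less than that
keeps the real part at least `r`. This keeps the complex power on its principal branch and bounds
the base away from `0` and infinity, uniformly in `u`. -/
lemma exists_ball_powTransform (hε : |ε| = 1) {x₀ : ℝ} (hx₀ : x₀ ∈ powDomain ε) :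
    ∃ r > 0, ∀ z ∈ Metric.ball (x₀ : ℂ) r, ∀ u ∈ Icc (-1 : ℝ) 1,
      (ε * (z - u) : ℂ) ∈ Complex.slitPlane ∧ r ≤ ‖(ε * (z - u) : ℂ)‖ ∧
      ‖(ε * (z - u) : ℂ)‖ ≤ |x₀| + r + 1 := by
  have hc : ContinuousOn (fun u : ℝ => ε * (x₀ - u)) (Icc (-1) 1) := by fun_prop
  obtain ⟨u₀, hu₀, hmin⟩ := isCompact_Icc.exists_isMinOn ⟨0, by norm_num⟩ hc
  refine ⟨ε * (x₀ - u₀) / 2, by have := hx₀ u₀ hu₀; positivity, fun z hz u hu => ?_⟩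
  set r := ε * (x₀ - u₀) / 2 with hr
  have hr0 : 0 < r := by have := hx₀ u₀ hu₀; positivity
  have hle : 2 * r ≤ ε * (x₀ - u) := by
    have : ε * (x₀ - u₀) ≤ ε * (x₀ - u) := hmin hu
    linarith
  have hre : (ε * (z - u) : ℂ).re = ε * (z.re - u) := by simp
  have hzr : |z.re - x₀| < r := by
    have := (Complex.abs_re_le_norm (z - x₀)).trans_lt (by simpa [dist_eq_norm] using hz)
    simpa using this
  have h1 : |ε * (z.re - x₀)| < r := by rw [abs_mul, hε, one_mul]; exact hzr
  have hre2 : r ≤ (ε * (z - u) : ℂ).re := by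
    rw [hre]
    have := (abs_lt.1 h1).1
    linarith
  refine ⟨Or.inl (hr0.trans_le hre2), hre2.trans (Complex.re_le_norm _), ?_⟩
  rw [norm_mul, Complex.norm_real, Real.norm_eq_abs, hε, one_mul]
  have hzx : ‖z - x₀‖ < r := by simpa [dist_eq_norm] using hz
  calc ‖z - u‖ = ‖(x₀ : ℂ) + (z - x₀) - u‖ := by ring_nf
    _ ≤ ‖(x₀ : ℂ)‖ + ‖z - x₀‖ + ‖(u : ℂ)‖ := (norm_sub_le _ _).trans
        (by gcongr; exact norm_add_le _ _)
    _ ≤ |x₀| + r + 1 := by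
        rw [Complex.norm_real, Complex.norm_real, Real.norm_eq_abs, Real.norm_eq_abs]
        have := abs_le.2 hu
        gcongr

/-- Differentiation under the integral over the complex numbers: holomorphy then yields real
analyticity with no power series estimates. -/
lemma hasDerivAt_complex_powTransform [IsFiniteMeasure μ] (hε : |ε| = 1)
    (hμ : ∀ᵐ u ∂μ, u ∈ Icc (-1 : ℝ) 1) (hh : Integrable h μ) {x₀ : ℝ} (hx₀ : x₀ ∈ powDomain ε) :
    ∃ r > 0, ∀ z ∈ Metric.ball (x₀ : ℂ) r, ∀ β : ℝ,
      HasDerivAt (fun z : ℂ => ∫ u, (h u : ℂ) * (ε * (z - u) : ℂ) ^ (β : ℂ) ∂μ)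
        (∫ u, (h u : ℂ) * (β * (ε * (z - u) : ℂ) ^ (β - 1 : ℂ) * ε) ∂μ) z := by
  obtain ⟨r, hr, H⟩ := exists_ball_powTransform hε hx₀
  refine ⟨r, hr, fun z hz β => ?_⟩
  have hmeas : ∀ (w : ℂ) (γ : ℂ),
      AEStronglyMeasurable (fun u : ℝ => (ε * (w - u) : ℂ) ^ γ) μ := fun w γ => by
    have h1 : Measurable (fun u : ℝ => (ε * (w - u) : ℂ)) := by fun_prop
    exact (h1.pow_const γ).aestronglyMeasurable
  have hbd : ∀ (γ : ℝ), ∀ w ∈ Metric.ball (x₀ : ℂ) r, ∀ u ∈ Icc (-1 : ℝ) 1,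
      ‖(ε * (w - u) : ℂ) ^ (γ : ℂ)‖ ≤ r ^ γ + (|x₀| + r + 1) ^ γ := fun γ w hw u hu => by
    obtain ⟨_, h1, h2⟩ := H w hw u hu
    rw [Complex.norm_cpow_real]
    exact Real.rpow_le_rpow_add_rpow hr h1 h2 γ
  have hhm : AEStronglyMeasurable (fun u => (h u : ℂ)) μ := 
    Complex.continuous_ofReal.comp_aestronglyMeasurable hh.aestronglyMeasurable
  refine (hasDerivAt_integral_of_dominated_loc_of_deriv_le
    (F := fun z u => (h u : ℂ) * (ε * (z - u) : ℂ) ^ (β : ℂ))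
    (F' := fun z u => (h u : ℂ) * (β * (ε * (z - u) : ℂ) ^ (β - 1 : ℂ) * ε))
    (bound := fun u => ‖h u‖ * (|β| * (r ^ (β - 1) + (|x₀| + r + 1) ^ (β - 1))))
    (Metric.isOpen_ball.mem_nhds hz) ?_ ?_ ?_ ?_ (hh.norm.mul_const _) ?_).2
  · exact Eventually.of_forall fun w => hhm.mul (hmeas w _)
  · refine Integrable.mono' (hh.norm.mul_const (r ^ β + (|x₀| + r + 1) ^ β)) (hhm.mul (hmeas z _)) ?_
    filter_upwards [hμ] with u hu
    rw [norm_mul, Complex.norm_real]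
    gcongr
    exact hbd β z hz u hu
  · exact hhm.mul (((hmeas z _).const_mul _).mul_const _)
  · filter_upwards [hμ] with u hu w hw
    rw [norm_mul, norm_mul, norm_mul, Complex.norm_real, Complex.norm_real, Complex.norm_real,
      Real.norm_eq_abs ε, hε, mul_one, Real.norm_eq_abs β]
    have := hbd (β - 1) w hw u hu
    push_cast at this
    gcongr
  · filter_upwards [hμ] with u hu w hw
    have h1 : HasDerivAt (fun w : ℂ => (ε * (w - u) : ℂ)) (ε : ℂ) w := by
      simpa using ((hasDerivAt_id w).sub_const (u : ℂ)).const_mul (ε : ℂ)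
    exact (h1.cpow_const (H w hw u hu).1).const_mul _

lemma complex_powTransform_ofReal (hμ : ∀ᵐ u ∂μ, u ∈ Icc (-1 : ℝ) 1) (β : ℝ) {x : ℝ}
    (hx : x ∈ powDomain ε) :
    ∫ u, (h u : ℂ) * (ε * (x - u) : ℂ) ^ (β : ℂ) ∂μ = (powTransform ε μ β h x : ℂ) := by
  rw [powTransform, ← integral_complex_ofReal]
  refine integral_congr_ae ?_
  filter_upwards [hμ] with u hu
  rw [Complex.ofReal_mul, Complex.ofReal_cpow (hx u hu).le]
  push_cast
  rfl

lemma analyticAt_powTransform [IsFiniteMeasure μ] (hε : |ε| = 1)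
    (hμ : ∀ᵐ u ∂μ, u ∈ Icc (-1 : ℝ) 1) (hh : Integrable h μ) (β : ℝ) {x : ℝ}
    (hx : x ∈ powDomain ε) : AnalyticAt ℝ (powTransform ε μ β h) x := by
  obtain ⟨r, hr, H⟩ := hasDerivAt_complex_powTransform hε hμ hh hx
  have h1 : AnalyticAt ℂ (fun z : ℂ => ∫ u, (h u : ℂ) * (ε * (z - u) : ℂ) ^ (β : ℂ) ∂μ) x :=
    DifferentiableOn.analyticAt (s := Metric.ball (x : ℂ) r)
      (fun z hz => (H z hz β).differentiableAt.differentiableWithinAt)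
      (Metric.ball_mem_nhds _ hr)
  refine h1.re_ofReal.congr ?_
  filter_upwards [(isOpen_powDomain ε).mem_nhds hx] with y hy
  rw [complex_powTransform_ofReal hμ β hy, Complex.ofReal_re]

lemma hasDerivAt_powTransform [IsFiniteMeasure μ] (hε : |ε| = 1)
    (hμ : ∀ᵐ u ∂μ, u ∈ Icc (-1 : ℝ) 1) (hh : Integrable h μ) (β : ℝ) {x : ℝ}
    (hx : x ∈ powDomain ε) :
    HasDerivAt (powTransform ε μ β h) (ε * β * powTransform ε μ (β - 1) h x) x := by
  obtain ⟨r, hr, H⟩ := hasDerivAt_complex_powTransform hε hμ hh hx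
  have h1 := (H x (Metric.mem_ball_self hr) β).real_of_complex
  have h2 : (∫ u, (h u : ℂ) * (β * (ε * (x - u) : ℂ) ^ (β - 1 : ℂ) * ε) ∂μ)
      = ((ε * β * powTransform ε μ (β - 1) h x : ℝ) : ℂ) := by
    rw [Complex.ofReal_mul, ← complex_powTransform_ofReal hμ (β - 1) hx, ← integral_const_mul]
    congr 1
    ext u
    push_cast
    ring
  rw [h2, Complex.ofReal_re] at h1
  refine h1.congr_of_eventuallyEq ?_
  filter_upwards [(isOpen_powDomain ε).mem_nhds hx] with y hy
  rw [complex_powTransform_ofReal hμ β hy, Complex.ofReal_re]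

lemma integrable_mul_rpow [IsFiniteMeasure μ]
    (hμ : ∀ᵐ u ∂μ, u ∈ Icc (-1 : ℝ) 1) (hh : Integrable h μ) (β : ℝ) {x : ℝ}
    (hx : x ∈ powDomain ε) : Integrable (fun u => h u * (ε * (x - u)) ^ β) μ := by
  have hc : ContinuousOn (fun u : ℝ => (ε * (x - u)) ^ β) (Icc (-1) 1) :=
    ContinuousOn.rpow_const (by fun_prop) fun u hu => Or.inl (hx u hu).ne'
  obtain ⟨C, hC⟩ := isCompact_Icc.exists_bound_of_continuousOn hc
  have hm : Measurable (fun u : ℝ => (ε * (x - u)) ^ β) := by fun_prop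
  refine hh.mul_bdd (c := C) hm.aestronglyMeasurable ?_
  filter_upwards [hμ] with u hu using hC u hu

lemma integrable_sub_mul (hμ : ∀ᵐ u ∂μ, u ∈ Icc (-1 : ℝ) 1) (hh : Integrable h μ) (v : ℝ) :
    Integrable (fun u => (u - v) * h u) μ := by
  refine hh.bdd_mul (c := 1 + |v|) (by fun_prop) ?_
  filter_upwards [hμ] with u hu
  have := abs_le.2 hu
  exact (norm_sub_le _ _).trans (by simpa using this)

/-- Elimination of the point `v`: the kernel `u ↦ (ε (x - u)) ^ β`, divided by its value at `v`,
has a derivative in `x` that vanishes at `v`. -/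
lemma hasDerivAt_rpow_neg_mul_powTransform [IsFiniteMeasure μ] (hε : |ε| = 1)
    (hμ : ∀ᵐ u ∂μ, u ∈ Icc (-1 : ℝ) 1) (hh : Integrable h μ) (β : ℝ) {v : ℝ}
    (hv : v ∈ Icc (-1 : ℝ) 1) {x : ℝ} (hx : x ∈ powDomain ε) :
    HasDerivAt ((fun x => (ε * (x - v)) ^ (-β)) * powTransform ε μ β h)
      (β * (ε * (x - v)) ^ (-β - 1) * powTransform ε μ (β - 1) (fun u => (u - v) * h u) x) x := by
  have hε2 : ε * ε = 1 := by rw [← abs_mul_abs_self, hε, one_mul]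
  have hpos := hx v hv
  have h1 : HasDerivAt (fun x : ℝ => ε * (x - v)) ε x := by
    simpa using ((hasDerivAt_id x).sub_const v).const_mul ε
  have h2 := (h1.rpow_const (p := -β) (Or.inl hpos.ne')).mul
    (hasDerivAt_powTransform hε hμ hh β hx)
  refine h2.congr_deriv ?_
  -- Integrate `ε (x - u) = ε (x - v) - ε (u - v)` against `h(u) (ε (x - u)) ^ (β - 1)`; the first
  -- term cancels in the derivative.
  have h3 : powTransform ε μ β h x = ε * (x - v) * powTransform ε μ (β - 1) h x
      - ε * powTransform ε μ (β - 1) (fun u => (u - v) * h u) x := by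
    unfold powTransform
    rw [← integral_const_mul, ← integral_const_mul, ← integral_sub
      ((integrable_mul_rpow hμ hh _ hx).const_mul _)
      ((integrable_mul_rpow hμ (integrable_sub_mul hμ hh v) _ hx).const_mul _)]
    refine integral_congr_ae ?_
    filter_upwards [hμ] with u hu
    have := hx u hu
    have h4 : (ε * (x - u)) ^ β = (ε * (x - u)) ^ (β - 1) * (ε * (x - u)) := by
      rw [← Real.rpow_add_one this.ne']; ring_nf
    rw [h4]
    ring
  have h5 : (ε * (x - v)) ^ (-β) = (ε * (x - v)) ^ (-β - 1) * (ε * (x - v)) := by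
    rw [← Real.rpow_add_one hpos.ne']; ring_nf
  rw [h3, h5]
  linear_combination ((ε * (x - v)) ^ (-β - 1) * β *
    powTransform ε μ (β - 1) (fun u => (u - v) * h u) x) * hε2

/-- The kernel is positive, so a density of constant sign with zero integral vanishes almost
everywhere. -/
lemma ae_eq_zero_of_powTransform_eq_zero [IsFiniteMeasure μ]
    (hμ : ∀ᵐ u ∂μ, u ∈ Icc (-1 : ℝ) 1) (hh : Integrable h μ) (β : ℝ) {s : ℝ} (hs : s ≠ 0)
    (hsign : ∀ᵐ u ∂μ, 0 ≤ s * h u) {x : ℝ} (hx : x ∈ powDomain ε)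
    (h0 : powTransform ε μ β h x = 0) : ∀ᵐ u ∂μ, h u = 0 := by
  have hint := (integrable_mul_rpow hμ hh β hx).const_mul s
  have hnn : 0 ≤ᵐ[μ] fun u => s * (h u * (ε * (x - u)) ^ β) := by
    filter_upwards [hsign, hμ] with u hu hu'
    rw [← mul_assoc]
    exact mul_nonneg hu (Real.rpow_nonneg (hx u hu').le _)
  have := (integral_eq_zero_iff_of_nonneg_ae hnn hint).1 (by
    rw [integral_const_mul]
    exact mul_eq_zero_of_right _ h0)
  filter_upwards [this, hμ] with u hu hu'
  have h1 := (Real.rpow_pos_of_pos (hx u hu') β).ne'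
  simpa [hs, h1] using hu

/-- The transform `∫ h(u) (ε (x - u)) ^ β dμ(u)` has at most as many zeros as `h` has sign changes,
the sign changes being those at the points of the list `l`. -/
theorem atMostIsolatedZeros_powTransform [IsFiniteMeasure μ] (hε : |ε| = 1)
    (hμ : ∀ᵐ u ∂μ, u ∈ Icc (-1 : ℝ) 1) (hJ : IsOpen J) (hJc : J.OrdConnected)
    (hJD : J ⊆ powDomain ε) {s : ℝ} (hs : s ≠ 0) :
    ∀ (l : List ℝ) (β : ℝ) {h : ℝ → ℝ}, (∀ v ∈ l, v ∈ Icc (-1 : ℝ) 1) → Integrable h μ →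
      (∀ᵐ u ∂μ, 0 ≤ s * (h u * (l.map fun v => u - v).prod)) →
      AtMostIsolatedZeros (powTransform ε μ β h) J l.length := by
  intro l
  induction l with
  | nil =>
    intro β h _ hh hsign
    refine AtMostIsolatedZeros.of_zero_imp hJ fun x hx hx0 y _ => ?_
    have h0 := ae_eq_zero_of_powTransform_eq_zero hμ hh β hs (by simpa using hsign) (hJD hx) hx0
    rw [powTransform, integral_eq_zero_of_ae]
    filter_upwards [h0] with u hu
    simp [hu]
  | cons v l ih =>
    intro β h hl hh hsign
    have hv := hl v (by simp)
    have hh' := integrable_sub_mul hμ hh v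
    have han : ∀ γ : ℝ, AnalyticOnNhd ℝ (fun x => (ε * (x - v)) ^ γ) J := fun γ x hx => by
      have h1 : AnalyticAt ℝ (fun x => ε * (x - v)) x := by fun_prop
      exact AnalyticAt.congr (((analyticAt_const (v := γ)).mul
        (h1.log (hJD hx v hv))).rexp) (by
          filter_upwards [(isOpen_powDomain ε).mem_nhds (hJD hx)] with y hy
          rw [Real.rpow_def_of_pos (hy v hv), mul_comm]
          rfl)
    have hanG : ∀ (γ : ℝ) {k : ℝ → ℝ}, Integrable k μ → AnalyticOnNhd ℝ (powTransform ε μ γ k) J :=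
      fun γ k hk x hx => analyticAt_powTransform hε hμ hk γ (hJD hx)
    have hne : ∀ (γ : ℝ), ∀ x ∈ J, (ε * (x - v)) ^ γ ≠ 0 := fun γ x hx =>
      (Real.rpow_pos_of_pos (hJD hx v hv) γ).ne'
    -- Dividing by the kernel at `v` preserves zeros, and differentiating costs one. The tail `l`
    -- then lists the sign changes of `(u - v) h`.
    refine AtMostIsolatedZeros.of_mul_left (hanG β hh) (han (-β)) (hne (-β)) hJ ?_
    refine AtMostIsolatedZeros.of_deriv hJc ((han _).mul (hanG β hh)) ?_
    have hderiv : EqOn (fun x => β * (ε * (x - v)) ^ (-β - 1) *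
        powTransform ε μ (β - 1) (fun u => (u - v) * h u) x)
        (deriv ((fun x => (ε * (x - v)) ^ (-β)) * powTransform ε μ β h)) J := fun x hx =>
      (hasDerivAt_rpow_neg_mul_powTransform hε hμ hh β hv (hJD hx)).deriv.symm
    refine AtMostIsolatedZeros.congr hJ hderiv ?_
    -- At exponent `0` the derivative is identically zero and has no isolated zeros; otherwise its
    -- factor `β` can be divided out.
    rcases eq_or_ne β 0 with rfl | hβ
    · exact AtMostIsolatedZeros.of_eqOn_zero hJ fun x _ => by simp
    refine (ih (β - 1) (fun w hw => hl w (by simp [hw])) hh' ?_).mul_left (hanG _ hh')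
      (g := fun x => β * (ε * (x - v)) ^ (-β - 1)) (analyticOnNhd_const.mul (han _))
      fun x hx => mul_ne_zero hβ (hne _ x hx)
    filter_upwards [hsign] with u hu
    rw [List.map_cons, List.prod_cons] at hu
    linarith

/-- The same elimination applied to the zero function: the exponents `β, β - 1, …` never reach `0`,
so vanishing passes down to the density of constant sign. -/
theorem prod_mul_ae_eq_zero_of_powTransform_eqOn_zero [IsFiniteMeasure μ] (hε : |ε| = 1)
    (hμ : ∀ᵐ u ∂μ, u ∈ Icc (-1 : ℝ) 1) (hJ : IsOpen J) (hJne : J.Nonempty)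
    (hJD : J ⊆ powDomain ε) {s : ℝ} (hs : s ≠ 0) :
    ∀ (l : List ℝ) (β : ℝ) {h : ℝ → ℝ}, (∀ n : ℕ, β ≠ n) → (∀ v ∈ l, v ∈ Icc (-1 : ℝ) 1) →
      Integrable h μ → (∀ᵐ u ∂μ, 0 ≤ s * (h u * (l.map fun v => u - v).prod)) →
      (∀ x ∈ J, powTransform ε μ β h x = 0) → ∀ᵐ u ∂μ, h u * (l.map fun v => u - v).prod = 0 := by
  intro l
  induction l with
  | nil =>
    intro β h _ _ hh hsign h0
    obtain ⟨x, hx⟩ := hJne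
    simpa using ae_eq_zero_of_powTransform_eq_zero hμ hh β hs (by simpa using hsign) (hJD hx)
      (h0 x hx)
  | cons v l ih =>
    intro β h hβ hl hh hsign h0
    have hv := hl v (by simp)
    have := ih (β - 1) (h := fun u => (u - v) * h u)
      (fun n hn => hβ (n + 1) (by push_cast; linarith)) (fun w hw => hl w (by simp [hw]))
      (integrable_sub_mul hμ hh v)
      (by
        filter_upwards [hsign] with u hu
        rw [List.map_cons, List.prod_cons] at hu
        linarith)
      (fun x hx => by
        have h1 := hasDerivAt_rpow_neg_mul_powTransform hε hμ hh β hv (hJD hx)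
        have h2 : (fun x => (ε * (x - v)) ^ (-β)) * powTransform ε μ β h =ᶠ[𝓝 x] fun _ => 0 := by
          filter_upwards [hJ.mem_nhds hx] with y hy
          simp [h0 y hy]
        have h3 := h1.unique ((hasDerivAt_const x (0 : ℝ)).congr_of_eventuallyEq h2)
        have h4 := (Real.rpow_pos_of_pos (hJD hx v hv) (-β - 1)).ne'
        have h5 : β ≠ 0 := by simpa using hβ 0
        simpa [h4, h5] using h3)
    filter_upwards [this] with u hu
    rw [List.map_cons, List.prod_cons]
    linarith

end

/-! ### Zeros of trigonometric polynomials in the variable `u = cos θ`. -/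

noncomputable section

open Polynomial in
/-- The polynomial `Q` with `(d/du)^m (√(1 - u²) U_j(u)) = (1 - u²) ^ (1/2 - m) Q(u)`. -/
def sqrtMulUDeriv (j : ℕ) : ℕ → ℝ[X]
  | 0 => Chebyshev.U ℝ j
  | m + 1 => (1 - X ^ 2) * derivative (sqrtMulUDeriv j m) + C (2 * (m : ℝ) - 1) * X * sqrtMulUDeriv j m

open Polynomial in
lemma sqrtMulUDeriv_one (j : ℕ) : sqrtMulUDeriv j 1 = -(C ((j : ℝ) + 1) * Chebyshev.T ℝ (j + 1)) := by
  have h := Chebyshev.add_one_mul_T_eq_poly_in_U (R := ℝ) j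
  simp only [sqrtMulUDeriv, Nat.cast_zero, mul_zero, zero_sub, map_neg, map_one, map_add]
  simp only [Int.cast_natCast] at h
  rw [show (C (j : ℝ) : ℝ[X]) = (j : ℝ[X]) by simp, h]
  ring

open Polynomial in
-- Write `Q_m` for these polynomials. If `Q_{m+1}' = c Q_m`, differentiating the recursion for
-- `Q_{m+2}` gives `(c + 2m + 1) Q_{m+1}`. The start is `T' = (j + 1) U`. The factor vanishes at `m
-- = j + 1`, which caps the degrees.
lemma derivative_sqrtMulUDeriv_succ (j m : ℕ) : derivative (sqrtMulUDeriv j (m + 1))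
    = C ((m : ℝ) ^ 2 - ((j : ℝ) + 1) ^ 2) * sqrtMulUDeriv j m := by
  induction m with
  | zero =>
    rw [zero_add, sqrtMulUDeriv_one, derivative_neg, derivative_C_mul, Chebyshev.T_derivative_eq_U]
    simp [sqrtMulUDeriv]
    ring
  | succ m ih =>
    have h1 : sqrtMulUDeriv j (m + 2) = (1 - X ^ 2) * derivative (sqrtMulUDeriv j (m + 1))
      + C (2 * ((m + 1 : ℕ) : ℝ) - 1) * X * sqrtMulUDeriv j (m + 1) := rfl
    have h2 : sqrtMulUDeriv j (m + 1) = (1 - X ^ 2) * derivative (sqrtMulUDeriv j m)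
      + C (2 * (m : ℝ) - 1) * X * sqrtMulUDeriv j m := rfl
    have h3 : ((m + 1 : ℕ) : ℝ) ^ 2 - ((j : ℝ) + 1) ^ 2
        = ((m : ℝ) ^ 2 - ((j : ℝ) + 1) ^ 2) + (2 * (m : ℝ) - 1) + 2 := by push_cast; ring
    have h4 : 2 * ((m + 1 : ℕ) : ℝ) - 1 = (2 * (m : ℝ) - 1) + 2 := by push_cast; ring
    have h5 : (C (2 : ℝ) : ℝ[X]) = 2 := rfl
    rw [h1, h3, h4, ih, derivative_add, derivative_mul, mul_assoc (C _) X, derivative_C_mul,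
      derivative_C_mul, derivative_mul, ih]
    simp only [derivative_sub, derivative_one, derivative_X_pow, derivative_X, C_add, h5]
    generalize C ((m : ℝ) ^ 2 - ((j : ℝ) + 1) ^ 2) = c at *
    generalize C (2 * (m : ℝ) - 1) = e at *
    simp only [Nat.cast_ofNat, h5, Nat.reduceSub, pow_one]
    linear_combination (-c) * h2

open Polynomial in
lemma natDegree_le_succ_of_natDegree_derivative_le {p : ℝ[X]} {n : ℕ}
    (h : (derivative p).natDegree ≤ n) : p.natDegree ≤ n + 1 := by
  rw [natDegree_derivative] at h
  omega

open Polynomial in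
-- At index `j + 2` the derivative is zero, so the polynomial is constant; each later index adds at
-- most one degree.
lemma natDegree_sqrtMulUDeriv_le (j i : ℕ) : (sqrtMulUDeriv j (j + 2 + i)).natDegree ≤ i := by
  induction i with
  | zero =>
    have h := derivative_sqrtMulUDeriv_succ j (j + 1)
    simp only [Nat.cast_add, Nat.cast_one, sub_self, map_zero, zero_mul] at h
    exact (Polynomial.derivative_eq_zero.1 h).le
  | succ i ih =>
    refine natDegree_le_succ_of_natDegree_derivative_le ?_
    have h := derivative_sqrtMulUDeriv_succ j (j + 2 + i)
    rw [← add_assoc, h]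
    exact (natDegree_C_mul_le _ _).trans ih

open Polynomial in
lemma atMostIsolatedZeros_eval {J : Set ℝ} (hJ : IsOpen J) (hJc : J.OrdConnected) {n : ℕ} :
    ∀ {p : ℝ[X]}, p.natDegree ≤ n → AtMostIsolatedZeros (fun u => p.eval u) J n := by
  induction n with
  | zero =>
    intro p hp
    rw [natDegree_eq_zero.1 (Nat.le_zero.1 hp) |>.choose_spec.symm]
    refine AtMostIsolatedZeros.of_zero_imp hJ fun x _ hx y _ => ?_
    simpa using hx
  | succ n ih =>
    intro p hp
    refine AtMostIsolatedZeros.of_deriv hJc ?_ ?_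
    · exact fun x _ => AnalyticOnNhd.eval_polynomial p x (mem_univ x)
    · have h := ih (p := derivative p) (by have := natDegree_derivative_le p; omega)
      exact h.congr hJ fun x _ => (Polynomial.deriv p).symm

/-- `A(u) + √(1 - u²) ∑ b_j U_j(u)`, a trigonometric polynomial in `θ = arccos u`. -/
def trigPoly (A : Polynomial ℝ) (s : Finset ℕ) (b : ℕ → ℝ) (u : ℝ) : ℝ :=
  A.eval u + √(1 - u ^ 2) * ∑ j ∈ s, b j * (Polynomial.Chebyshev.U ℝ j).eval u

lemma one_sub_sq_pos {u : ℝ} (hu : u ∈ Ioo (-1 : ℝ) 1) : 0 < 1 - u ^ 2 := by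
  nlinarith [hu.1, hu.2]

lemma analyticAt_one_sub_sq_rpow (γ : ℝ) {u : ℝ} (hu : u ∈ Ioo (-1 : ℝ) 1) :
    AnalyticAt ℝ (fun u : ℝ => (1 - u ^ 2) ^ γ) u := by
  have h1 : AnalyticAt ℝ (fun u : ℝ => 1 - u ^ 2) u := by fun_prop
  refine AnalyticAt.congr (((analyticAt_const (v := γ)).mul (h1.log (one_sub_sq_pos hu))).rexp) ?_
  filter_upwards [isOpen_Ioo.mem_nhds hu] with y hy
  rw [Real.rpow_def_of_pos (one_sub_sq_pos hy), mul_comm]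
  rfl

open Polynomial in
lemma analyticOnNhd_eval_add_rpow_mul_eval (p q : ℝ[X]) (γ : ℝ) :
    AnalyticOnNhd ℝ (fun u => p.eval u + (1 - u ^ 2) ^ γ * q.eval u) (Ioo (-1) 1) := by
  intro u hu
  have hp : AnalyticAt ℝ (fun u => p.eval u) u :=
    AnalyticOnNhd.eval_polynomial p u (mem_univ u)
  have hq : AnalyticAt ℝ (fun u => q.eval u) u :=
    AnalyticOnNhd.eval_polynomial q u (mem_univ u)
  exact hp.add ((analyticAt_one_sub_sq_rpow γ hu).mul hq)

lemma trigPoly_eq (A : Polynomial ℝ) (s : Finset ℕ) (b : ℕ → ℝ) (u : ℝ) :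
    trigPoly A s b u = A.eval u + (1 - u ^ 2) ^ (1 / 2 - ((0 : ℕ) : ℝ)) *
      (∑ j ∈ s, Polynomial.C (b j) * sqrtMulUDeriv j 0).eval u := by
  simp [trigPoly, sqrtMulUDeriv, Real.sqrt_eq_rpow, Polynomial.eval_finsetSum]

lemma analyticOnNhd_trigPoly (A : Polynomial ℝ) (s : Finset ℕ) (b : ℕ → ℝ) :
    AnalyticOnNhd ℝ (trigPoly A s b) (Ioo (-1) 1) := by
  rw [funext (trigPoly_eq A s b)]
  exact analyticOnNhd_eval_add_rpow_mul_eval _ _ _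

open Polynomial in
lemma hasDerivAt_eval_add_rpow_mul_sum (A : ℝ[X]) (s : Finset ℕ) (b : ℕ → ℝ) (m : ℕ) {u : ℝ}
    (hu : u ∈ Ioo (-1 : ℝ) 1) :
    HasDerivAt (fun u => A.eval u + (1 - u ^ 2) ^ (1 / 2 - (m : ℝ)) *
        (∑ j ∈ s, C (b j) * sqrtMulUDeriv j m).eval u)
      ((derivative A).eval u + (1 - u ^ 2) ^ (1 / 2 - ((m + 1 : ℕ) : ℝ)) *
        (∑ j ∈ s, C (b j) * sqrtMulUDeriv j (m + 1)).eval u) u := by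
  have hpos := one_sub_sq_pos hu
  have h1 : HasDerivAt (fun u : ℝ => 1 - u ^ 2) (-(2 * u)) u := by
    simpa using (hasDerivAt_pow 2 u).const_sub 1
  have h2 := h1.rpow_const (p := 1 / 2 - (m : ℝ)) (Or.inl hpos.ne')
  set P : ℝ[X] := ∑ j ∈ s, C (b j) * sqrtMulUDeriv j m with hP
  have hP' : ∑ j ∈ s, C (b j) * sqrtMulUDeriv j (m + 1)
      = (1 - X ^ 2) * derivative P + C (2 * (m : ℝ) - 1) * X * P := by
    simp only [hP, derivative_sum, Finset.mul_sum, ← Finset.sum_add_distrib, sqrtMulUDeriv,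
      derivative_C_mul]
    refine Finset.sum_congr rfl fun j _ => by ring
  refine ((A.hasDerivAt u).add (h2.mul (P.hasDerivAt u))).congr_deriv ?_
  have h3 : (1 - u ^ 2) ^ (1 / 2 - (m : ℝ)) = (1 - u ^ 2) ^ (1 / 2 - (m : ℝ) - 1) * (1 - u ^ 2) := by
    rw [← Real.rpow_add_one hpos.ne']; ring_nf
  have h4 : 1 / 2 - ((m + 1 : ℕ) : ℝ) = 1 / 2 - (m : ℝ) - 1 := by push_cast; ring
  rw [hP', h4, h3]
  simp
  ring

open Polynomial in
/-- A trigonometric polynomial of degree at most `n` whose sine part starts with `sin ((n - d) θ)`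
has at most `n + 1 + d` zeros in `(0, π)`. -/
theorem atMostIsolatedZeros_trigPoly {A : ℝ[X]} {n d : ℕ} (hA : A.natDegree ≤ n) {s : Finset ℕ}
    (hs : ∀ j ∈ s, j + 1 ≤ n) {b : ℕ → ℝ} (hb : ∀ j ∈ s, j + 1 + d < n → b j = 0) :
    AtMostIsolatedZeros (trigPoly A s b) (Ioo (-1) 1) (d + (n + 1)) := by
  have key : ∀ (m N : ℕ), AtMostIsolatedZeros (fun u => (derivative^[m] A).eval u +
      (1 - u ^ 2) ^ (1 / 2 - (m : ℝ)) * (∑ j ∈ s, C (b j) * sqrtMulUDeriv j m).eval u)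
      (Ioo (-1) 1) N → AtMostIsolatedZeros (trigPoly A s b) (Ioo (-1) 1) (N + m) := by
    intro m
    induction m with
    | zero =>
      intro N h
      exact h.congr isOpen_Ioo fun u _ => (trigPoly_eq A s b u).symm
    | succ m ih =>
      intro N h
      rw [Nat.add_succ, ← Nat.succ_add]
      refine ih (N + 1) (AtMostIsolatedZeros.of_deriv ordConnected_Ioo
        (analyticOnNhd_eval_add_rpow_mul_eval _ _ _) (h.congr isOpen_Ioo fun u hu => ?_))
      rw [(hasDerivAt_eval_add_rpow_mul_sum (derivative^[m] A) s b m hu).deriv,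
        Function.iterate_succ_apply']
  refine key (n + 1) d ?_
  -- After `n + 1` derivatives only the sine part is left. Frequency `j + 1` contributes degree at
  -- most `n - (j + 1)`, hence at most `d`.
  rw [iterate_derivative_eq_zero (Nat.lt_succ_of_le hA)]
  have hdeg : (∑ j ∈ s, C (b j) * sqrtMulUDeriv j (n + 1)).natDegree ≤ d := by
    refine natDegree_sum_le_of_forall_le _ _ fun j hj => ?_
    by_cases hjd : j + 1 + d < n
    · simp [hb j hj hjd]
    · obtain ⟨i, hi⟩ := Nat.exists_eq_add_of_le (hs j hj)
      rw [show n + 1 = j + 2 + i by omega]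
      exact ((natDegree_C_mul_le _ _).trans (natDegree_sqrtMulUDeriv_le j i)).trans (by omega)
  refine ((atMostIsolatedZeros_eval isOpen_Ioo ordConnected_Ioo hdeg).mul_left
    (fun u _ => AnalyticOnNhd.eval_polynomial _ u (mem_univ u))
    (g := fun u => (1 - u ^ 2) ^ (1 / 2 - ((n + 1 : ℕ) : ℝ)))
    (fun u hu => analyticAt_one_sub_sq_rpow _ hu)
    (fun u hu => (Real.rpow_pos_of_pos (one_sub_sq_pos hu) _).ne')).congr isOpen_Ioo fun u _ => ?_
  simp

open Polynomial in
-- Multiplying by the conjugate gives the polynomial identity `A² + (X² - 1) B² = 0`. At real points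
-- `u > 1` both terms are non-negative, so `A` and `B` have infinitely many roots.
lemma eq_zero_of_trigPoly_eq_zero {A : ℝ[X]} {s : Finset ℕ} {b : ℕ → ℝ} {S : Set ℝ}
    (hS : S.Infinite) (hSI : S ⊆ Ioo (-1) 1) (h : ∀ u ∈ S, trigPoly A s b u = 0) :
    A = 0 ∧ ∑ j ∈ s, C (b j) * Chebyshev.U ℝ j = 0 := by
  set B : ℝ[X] := ∑ j ∈ s, C (b j) * Chebyshev.U ℝ j with hB
  have h1 : A ^ 2 + (X ^ 2 - 1) * B ^ 2 = 0 := by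
    refine eq_zero_of_infinite_isRoot _ (hS.mono ?_)
    intro u hu
    have h2 : A.eval u + √(1 - u ^ 2) * B.eval u = 0 := by
      have := h u hu
      rw [trigPoly] at this
      simpa [hB, eval_finsetSum] using this
    have h3 : √(1 - u ^ 2) ^ 2 = 1 - u ^ 2 := Real.sq_sqrt (one_sub_sq_pos (hSI hu)).le
    simp only [mem_ofPred_eq, IsRoot.def, eval_add, eval_pow, eval_mul, eval_sub, eval_X, eval_one]
    linear_combination (A.eval u - √(1 - u ^ 2) * B.eval u) * h2 + (B.eval u) ^ 2 * h3
  have h4 : ∀ u ∈ Ioi (1 : ℝ), A.eval u = 0 ∧ B.eval u = 0 := by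
    intro u hu
    have h5 := congrArg (eval u) h1
    simp only [eval_add, eval_pow, eval_mul, eval_sub, eval_X, eval_one, eval_zero] at h5
    have h6 : 0 < u ^ 2 - 1 := by nlinarith [mem_Ioi.1 hu]
    have h7 : (A.eval u) ^ 2 = 0 := by
      have := mul_nonneg h6.le (sq_nonneg (B.eval u))
      have := sq_nonneg (A.eval u)
      linarith
    rw [h7, zero_add] at h5
    exact ⟨by simpa using h7, by simpa [h6.ne'] using h5⟩
  exact ⟨eq_zero_of_infinite_isRoot _ ((Ioi_infinite 1).mono fun u hu => (h4 u hu).1),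
    eq_zero_of_infinite_isRoot _ ((Ioi_infinite 1).mono fun u hu => (h4 u hu).2)⟩

open Polynomial in
lemma eq_zero_of_sum_C_mul_eq_zero {p : ℕ → ℝ[X]} (hp : ∀ j, (p j).degree = j) {N : ℕ}
    {c : ℕ → ℝ} (h : ∑ j ∈ Finset.range N, C (c j) * p j = 0) : ∀ j < N, c j = 0 := by
  have hli : LinearIndependent ℝ p :=
    Polynomial.Sequence.linearIndependent ⟨p, hp⟩
  have := linearIndependent_iff'.1 hli (Finset.range N) c (by simpa [smul_eq_C_mul] using h)
  exact fun j hj => this j (Finset.mem_range.2 hj)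

end

/-! ### The Chebyshev list as a power transform. -/

noncomputable section

lemma AtMostIsolatedZeros.comp_const_add {f : ℝ → ℝ} {J : Set ℝ} {N : ℕ} (a : ℝ)
    (hf : AnalyticOnNhd ℝ f ((fun x => x - a) ⁻¹' J))
    (h : AtMostIsolatedZeros f ((fun x => x - a) ⁻¹' J) N) :
    AtMostIsolatedZeros (fun x => f (a + x)) J N := by
  have hg : ∀ x, AnalyticAt ℝ (fun x : ℝ => a + x) x := fun x => by fun_prop
  have hord : ∀ x, analyticOrderAt (fun x => f (a + x)) x = analyticOrderAt f (a + x) := fun x =>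
    analyticOrderAt_comp_of_deriv_ne_zero (f := f) (hg x) (by simp)
  have hmem : ∀ {x}, x ∈ J → a + x ∈ (fun x => x - a) ⁻¹' J := fun hx => by simpa using hx
  intro Z hZ
  have := h (Z.map (addLeftEmbedding a)) (by
    intro y hy
    obtain ⟨x, hx, rfl⟩ := Finset.mem_map.1 hy
    have hfx := hf _ (hmem (hZ x hx).1)
    have h1 := (isIsolatedZero_iff (f := fun x => f (a + x))
      (AnalyticAt.fun_comp (g := f) hfx (hg x))).1 (hZ x hx).2
    rw [hord] at h1
    exact ⟨hmem (hZ x hx).1, (isIsolatedZero_iff hfx).2 h1⟩)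
  rw [Finset.sum_map] at this
  simpa [hord] using this

/-- The push-forward of Lebesgue measure on `(0, π)` under the cosine, plus unit masses at `±1`. -/
def cosMeasure : Measure ℝ :=
  (volume.restrict (Ioo 0 Real.pi)).map Real.cos + (Measure.dirac 1 + Measure.dirac (-1))

instance : IsFiniteMeasure ((volume : Measure ℝ).restrict (Ioo 0 Real.pi)) :=
  ⟨by simp⟩

instance : IsFiniteMeasure cosMeasure := by
  unfold cosMeasure; infer_instance

lemma ae_cosMeasure_of_forall_Icc {P : ℝ → Prop} (h : ∀ u ∈ Icc (-1 : ℝ) 1, P u) :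
    ∀ᵐ u ∂cosMeasure, P u := by
  have : ∀ᵐ u ∂cosMeasure, u ∈ Icc (-1 : ℝ) 1 := by
    simp only [cosMeasure, ae_add_measure_iff, ae_dirac_eq, eventually_pure]
    refine ⟨?_, by norm_num, by norm_num⟩
    refine (ae_map_iff (by fun_prop) (measurableSet_Icc (a := (-1 : ℝ)) (b := 1))).2 ?_
    exact Eventually.of_forall fun θ => ⟨Real.neg_one_le_cos θ, Real.cos_le_one θ⟩
  exact this.mono h

lemma cos_mem_Ioo {θ : ℝ} (hθ : θ ∈ Ioo 0 Real.pi) : Real.cos θ ∈ Ioo (-1 : ℝ) 1 := by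
  have := Real.sin_pos_of_pos_of_lt_pi hθ.1 hθ.2
  have := Real.sin_sq_add_cos_sq θ
  constructor <;> nlinarith

/-- The density with respect to `cosMeasure`: `c₁` at `1`, `c₂` at `-1`, `g` in `(-1, 1)`. -/
def endpointDensity (c₁ c₂ : ℝ) (g : ℝ → ℝ) (u : ℝ) : ℝ :=
  if u = 1 then c₁ else if u = -1 then c₂ else g u

variable {c₁ c₂ : ℝ} {g : ℝ → ℝ}

@[simp] lemma endpointDensity_one : endpointDensity c₁ c₂ g 1 = c₁ := by simp [endpointDensity]

@[simp] lemma endpointDensity_neg_one : endpointDensity c₁ c₂ g (-1) = c₂ := by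
  norm_num [endpointDensity]

lemma endpointDensity_of_mem {u : ℝ} (hu : u ∈ Ioo (-1 : ℝ) 1) :
    endpointDensity c₁ c₂ g u = g u := by
  simp [endpointDensity, hu.1.ne', hu.2.ne]

lemma measurable_endpointDensity (hg : Continuous g) : Measurable (endpointDensity c₁ c₂ g) :=
  Measurable.ite (measurableSet_singleton 1) measurable_const
    (Measurable.ite (measurableSet_singleton (-1)) measurable_const hg.measurable)

lemma integrable_endpointDensity (hg : Continuous g) :
    Integrable (endpointDensity c₁ c₂ g) cosMeasure := by
  refine Integrable.add_measure ?_ (Integrable.add_measure ?_ ?_)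
  · rw [integrable_map_measure (measurable_endpointDensity hg).aestronglyMeasurable (by fun_prop)]
    have h1 : IntegrableOn (fun θ => g (Real.cos θ)) (Ioo 0 Real.pi) :=
      ((hg.comp Real.continuous_cos).integrableOn_Icc).mono_set Ioo_subset_Icc_self
    refine Integrable.congr h1 ?_
    filter_upwards [ae_restrict_mem measurableSet_Ioo] with θ hθ
    exact (endpointDensity_of_mem (cos_mem_Ioo hθ)).symm
  · exact integrable_dirac (by simp)
  · exact integrable_dirac (by simp)

lemma powTransform_endpointDensity (hg : Continuous g) {ε : ℝ} (β : ℝ) {x : ℝ}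
    (hx : x ∈ powDomain ε) :
    powTransform ε cosMeasure β (endpointDensity c₁ c₂ g) x =
      c₁ * (ε * (x - 1)) ^ β + c₂ * (ε * (x + 1)) ^ β +
      ∫ θ in Icc 0 Real.pi, g (Real.cos θ) * (ε * (x - Real.cos θ)) ^ β := by
  have hint := integrable_mul_rpow (ae_cosMeasure_of_forall_Icc fun u hu => hu)
    (integrable_endpointDensity (c₁ := c₁) (c₂ := c₂) hg) β hx
  have hm : Measurable (fun u => endpointDensity c₁ c₂ g u * (ε * (x - u)) ^ β) :=
    (measurable_endpointDensity hg).mul (by fun_prop)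
  unfold powTransform
  unfold cosMeasure at hint ⊢
  rw [integral_add_measure hint.left_of_add_measure hint.right_of_add_measure,
    integral_add_measure hint.right_of_add_measure.left_of_add_measure
      hint.right_of_add_measure.right_of_add_measure, integral_dirac, integral_dirac,
    integral_map (by fun_prop) hm.aestronglyMeasurable, integral_Icc_eq_integral_Ioo,
    endpointDensity_one, endpointDensity_neg_one, sub_neg_eq_add, add_comm]
  congr 1
  refine setIntegral_congr_fun measurableSet_Ioo fun θ hθ => ?_
  simp only [endpointDensity_of_mem (cos_mem_Ioo hθ)]

lemma trigPoly_cos (A : Polynomial ℝ) (s : Finset ℕ) (b : ℕ → ℝ) {θ : ℝ}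
    (hθ : θ ∈ Icc 0 Real.pi) : trigPoly A s b (Real.cos θ)
      = A.eval (Real.cos θ) + ∑ j ∈ s, b j * Real.sin (((j + 1 : ℕ) : ℝ) * θ) := by
  have h1 : √(1 - Real.cos θ ^ 2) = Real.sin θ := by
    rw [← Real.sin_sq, Real.sqrt_sq (Real.sin_nonneg_of_nonneg_of_le_pi hθ.1 hθ.2)]
  rw [trigPoly, h1, Finset.mul_sum]
  congr 1
  refine Finset.sum_congr rfl fun j _ => ?_
  have := Polynomial.Chebyshev.U_real_cos θ j
  push_cast at this ⊢
  rw [← this]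
  ring

lemma continuous_trigPoly (A : Polynomial ℝ) (s : Finset ℕ) (b : ℕ → ℝ) :
    Continuous (trigPoly A s b) := by
  unfold trigPoly
  fun_prop

/-- The cosine part of a trigonometric polynomial in terms of `u = cos θ`. -/
def cosPart (a : ℕ → ℝ) (N : ℕ) : Polynomial ℝ :=
  ∑ k ∈ Finset.range N, Polynomial.C (a k) * Polynomial.Chebyshev.T ℝ k

lemma eval_cosPart (a : ℕ → ℝ) (N : ℕ) (θ : ℝ) :
    (cosPart a N).eval (Real.cos θ) = ∑ k ∈ Finset.range N, a k * Real.cos (k * θ) := by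
  simp [cosPart, Polynomial.eval_finsetSum]

lemma natDegree_cosPart_le {a : ℕ → ℝ} {N d : ℕ} (ha : ∀ k, d < k → a k = 0) :
    (cosPart a N).natDegree ≤ d := by
  refine Polynomial.natDegree_sum_le_of_forall_le _ _ fun k _ => ?_
  by_cases hk : d < k
  · simp [ha k hk]
  · refine (Polynomial.natDegree_C_mul_le _ _).trans ?_
    rw [Polynomial.Chebyshev.natDegree_T]
    simpa using hk

/-- On the domain of `ρ`, the branch power is a constant multiple of a usual power. -/
lemma branchPow_eq {σ ε τ y : ℝ} (hετ : ε = 1 ∧ τ = 1 ∨ ε = -1 ∧ τ = σ) (hy : 0 < ε * y) (β : ℝ) :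
    branchPow σ y β = τ * (ε * y) ^ β := by
  rcases hετ with ⟨rfl, rfl⟩ | ⟨rfl, rfl⟩
  · rw [branchPow, if_neg (by linarith)]; simp
  · rw [branchPow, if_pos (by linarith), abs_of_neg (by linarith), neg_one_mul]

/-- The combination `Σ_k a_k 𝒞_k + Σ_j b_j 𝒮_{j+1}` as a single integral. -/
lemma sum_cosIntegral_add_sum_sinIntegral {σ ε τ : ℝ}
    (hετ : ε = 1 ∧ τ = 1 ∨ ε = -1 ∧ τ = σ) (β : ℝ) {ρ : ℝ} (hρ : 1 + ρ ∈ powDomain ε)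
    (a b : ℕ → ℝ) (N M : ℕ) :
    ∑ k ∈ Finset.range N, a k * cosIntegral σ (Icc 0 Real.pi) k β ρ +
      ∑ j ∈ Finset.range M, b j * sinIntegral σ (Icc 0 Real.pi) (j + 1) β ρ =
    τ * ∫ θ in Icc 0 Real.pi, trigPoly (cosPart a N) (Finset.range M) b (Real.cos θ) *
      (ε * (1 + ρ - Real.cos θ)) ^ β := by
  have hpos : ∀ θ, 0 < ε * (1 + ρ - Real.cos θ) := fun θ =>
    hρ _ ⟨Real.neg_one_le_cos θ, Real.cos_le_one θ⟩
  have hb : ∀ θ, branchPow σ (1 + ρ - Real.cos θ) β = τ * (ε * (1 + ρ - Real.cos θ)) ^ β :=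
    fun θ => branchPow_eq hετ (hpos θ) β
  have hc : Continuous fun θ => (ε * (1 + ρ - Real.cos θ)) ^ β :=
    Continuous.rpow_const (by fun_prop) fun θ => Or.inl (hpos θ).ne'
  simp only [cosIntegral, sinIntegral, hb, ← integral_const_mul]
  rw [← integral_finsetSum _ fun k _ => Continuous.integrableOn_Icc (by fun_prop),
    ← integral_finsetSum _ fun k _ => Continuous.integrableOn_Icc (by fun_prop),
    ← integral_add (Continuous.integrableOn_Icc (by fun_prop))
      (Continuous.integrableOn_Icc (by fun_prop))]
  refine setIntegral_congr_fun measurableSet_Icc fun θ hθ => ?_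
  simp only [trigPoly_cos _ _ _ hθ, eval_cosPart, add_mul, mul_add, Finset.sum_mul, Finset.mul_sum]
  congr 1 <;> exact Finset.sum_congr rfl fun _ _ => by ring

section List

variable (σ β : ℝ) {m : ℕ}

lemma length_chebyshevList (hm : 1 ≤ m) : (chebyshevList σ β m).length = 4 * m + 2 := by
  simp [chebyshevList]
  omega

/-- The linear combination of the Chebyshev list with the coefficients `c`. -/
def chebyshevSum (σ β : ℝ) (m : ℕ) (c : ℕ → ℝ) (ρ : ℝ) : ℝ :=
  ∑ i ∈ Finset.range (4 * m + 2), c i * (chebyshevList σ β m).getD i 0 ρ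

lemma sum_fin_mul_get (hm : 1 ≤ m) {k : ℕ} (hk : k ≤ (chebyshevList σ β m).length) (a : Fin k → ℝ)
    (ρ : ℝ) : ∑ i, a i * (chebyshevList σ β m).get (Fin.castLE hk i) ρ
      = chebyshevSum σ β m (fun i => if h : i < k then a ⟨i, h⟩ else 0) ρ := by
  have hk' : k ≤ 4 * m + 2 := (length_chebyshevList σ β hm) ▸ hk
  rw [chebyshevSum, ← Finset.sum_subset (Finset.range_mono hk'), ← Fin.sum_univ_eq_sum_range
    (fun i => (if h : i < k then a ⟨i, h⟩ else 0) * (chebyshevList σ β m).getD i 0 ρ)]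
  · refine Finset.sum_congr rfl fun i _ => ?_
    have : (i : ℕ) < (chebyshevList σ β m).length := i.2.trans_le hk
    rw [List.getD_eq_getElem _ _ this]
    simp
  · intro i _ hi
    simp only [Finset.mem_range] at hi
    simp [hi]

/-- The sines are listed by decreasing frequency, hence the reflected index in their coefficients.
-/
lemma chebyshevSum_eq (hm : 1 ≤ m) (c : ℕ → ℝ) (ρ : ℝ) :
    chebyshevSum σ β m c ρ = c 0 + (c 1 * branchPow σ ρ β + c 2 * branchPow σ (ρ + 2) β) +
      (∑ k ∈ Finset.range (2 * m), c (3 + k) * cosIntegral σ (Icc 0 Real.pi) k β ρ +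
      ∑ j ∈ Finset.range (2 * m - 1),
        c (3 + 2 * m + (2 * m - 1 - 1 - j)) * sinIntegral σ (Icc 0 Real.pi) (j + 1) β ρ) := by
  have hlen : 4 * m + 2 = 3 + 2 * m + (2 * m - 1) := by omega
  rw [chebyshevSum, hlen, Finset.sum_range_add, Finset.sum_range_add, ← Finset.sum_range_reflect
    (fun j => c (3 + 2 * m + j) * (chebyshevList σ β m).getD (3 + 2 * m + j) 0 ρ), add_assoc]
  congr 1
  · simp [Finset.sum_range_succ, chebyshevList]
    ring
  congr 1
  · refine Finset.sum_congr rfl fun k hk => ?_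
    have hk := Finset.mem_range.1 hk
    congr 1
    rw [show 3 + k = k + 1 + 1 + 1 by omega]
    simp only [chebyshevList, List.cons_append, List.nil_append, List.getD_cons_succ]
    rw [List.getD_eq_getElem _ _ (by simp; omega)]
    simp [hk]
  · refine Finset.sum_congr rfl fun k hk => ?_
    have hk := Finset.mem_range.1 hk
    congr 1
    rw [show 3 + 2 * m + (2 * m - 1 - 1 - k) = 2 * m + (2 * m - 1 - 1 - k) + 1 + 1 + 1 by omega]
    have : 2 * m - 1 - 1 - (2 * m - 1 - 1 - k) = k := by omega
    simp only [chebyshevList, List.cons_append, List.nil_append, List.getD_cons_succ]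
    rw [List.getD_eq_getElem _ _ (by simp; omega)]
    simp [this]

end List

end

/-! ### Sign changes of the density, the zero bound and linear independence. -/

noncomputable section

/-- The trigonometric polynomial in a linear combination of the Chebyshev list. -/
def chebyshevTrigPoly (m : ℕ) (c : ℕ → ℝ) : ℝ → ℝ :=
  trigPoly (cosPart (fun k => c (3 + k)) (2 * m)) (Finset.range (2 * m - 1))
    fun j => c (3 + 2 * m + (2 * m - 1 - 1 - j))

lemma chebyshevTrigPoly_eq_zero {m : ℕ} {c : ℕ → ℝ} (hc : ∀ i, 3 ≤ i → c i = 0) (u : ℝ) :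
    chebyshevTrigPoly m c u = 0 := by
  have h1 : ∀ j, c (3 + j) = 0 := fun j => hc _ (by omega)
  have h2 : ∀ j, c (3 + 2 * m + j) = 0 := fun j => hc _ (by omega)
  simp [chebyshevTrigPoly, trigPoly, cosPart, h1, h2]

/-- The density with respect to `cosMeasure` of a linear combination of the Chebyshev list. -/
def chebyshevDensity (m : ℕ) (c : ℕ → ℝ) : ℝ → ℝ :=
  endpointDensity (c 1) (c 2) (chebyshevTrigPoly m c)

lemma integrable_chebyshevDensity (m : ℕ) (c : ℕ → ℝ) :
    Integrable (chebyshevDensity m c) cosMeasure :=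
  integrable_endpointDensity (continuous_trigPoly _ _ _)

lemma chebyshevSum_eq_powTransform {m : ℕ} (hm : 1 ≤ m) {σ ε τ : ℝ}
    (hετ : ε = 1 ∧ τ = 1 ∨ ε = -1 ∧ τ = σ) (β : ℝ) {ρ : ℝ} (hρ : 1 + ρ ∈ powDomain ε)
    (c : ℕ → ℝ) : chebyshevSum σ β m c ρ
      = c 0 + τ * powTransform ε cosMeasure β (chebyshevDensity m c) (1 + ρ) := by
  rw [chebyshevSum_eq σ β hm, sum_cosIntegral_add_sum_sinIntegral hετ β hρ (fun k => c (3 + k))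
    (fun j => c (3 + 2 * m + (2 * m - 1 - 1 - j))), chebyshevDensity,
    chebyshevTrigPoly, powTransform_endpointDensity (continuous_trigPoly _ _ _) β hρ]
  have h1 : 0 < ε * ρ := by simpa using hρ 1 (by norm_num)
  have h2 : 0 < ε * (ρ + 2) := by
    have := hρ (-1) (by norm_num)
    rwa [show 1 + ρ - -1 = ρ + 2 by ring] at this
  rw [branchPow_eq hετ h1, branchPow_eq hετ h2, show 1 + ρ - 1 = ρ by ring,
    show 1 + ρ + 1 = ρ + 2 by ring]
  ring

/-- The factor `u - 1` kills the mass at `1`, leaving only the value `-2 c₂` at `-1`. -/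
lemma endpointDensity_sign_of_zero (c₁ c₂ : ℝ) {g : ℝ → ℝ} (hg : ∀ u, g u = 0) :
    ∃ s : ℝ, s ≠ 0 ∧ ∀ u, 0 ≤ s * (endpointDensity c₁ c₂ g u * (u - 1)) := by
  refine ⟨if c₂ = 0 then 1 else -c₂, by split_ifs with h <;> simp [h], fun u => ?_⟩
  unfold endpointDensity
  split_ifs with h h1 h2 h1 h2 <;> subst_vars <;> simp [hg]
  nlinarith [sq_nonneg c₂]

/-- With cosines only, this is a polynomial in `u` of degree at most `k - 4`. Once sines enter, the
decreasing order of frequencies matters: with `n = 2m - 1` only the frequencies from `n - d` up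
occur, and `d + (n + 1) = k - 4`. -/
lemma atMostIsolatedZeros_chebyshevTrigPoly {m k : ℕ} (hm : 1 ≤ m) (hk : 4 ≤ k) {c : ℕ → ℝ}
    (hc : ∀ i, k ≤ i → c i = 0) :
    AtMostIsolatedZeros (chebyshevTrigPoly m c) (Ioo (-1) 1) (k - 4) := by
  unfold chebyshevTrigPoly
  by_cases hkm : k ≤ 3 + 2 * m
  · have h := atMostIsolatedZeros_eval (J := Ioo (-1) 1) isOpen_Ioo ordConnected_Ioo
      (natDegree_cosPart_le (a := fun k => c (3 + k)) (N := 2 * m) (d := k - 4)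
        fun i hi => hc _ (by omega))
    refine h.congr isOpen_Ioo fun u _ => ?_
    have : ∀ j, c (3 + 2 * m + j) = 0 := fun j => hc _ (by omega)
    simp [trigPoly, this]
  · have hA : (cosPart (fun k => c (3 + k)) (2 * m)).natDegree ≤ 2 * m - 1 := by
      refine Polynomial.natDegree_sum_le_of_forall_le _ _ fun i hi => ?_
      refine (Polynomial.natDegree_C_mul_le _ _).trans ?_
      rw [Polynomial.Chebyshev.natDegree_T]
      have := Finset.mem_range.1 hi
      simp only [Int.natAbs_natCast]
      omega
    have h := atMostIsolatedZeros_trigPoly (d := k - (3 + 2 * m) - 1) hA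
      (s := Finset.range (2 * m - 1)) (fun j hj => by have := Finset.mem_range.1 hj; omega)
      (b := fun j => c (3 + 2 * m + (2 * m - 1 - 1 - j)))
      (fun j hj hjd => hc _ (by omega))
    exact h.mono (by omega)

lemma exists_list_sign_chebyshevDensity {m N : ℕ} {c : ℕ → ℝ}
    (h : AtMostIsolatedZeros (chebyshevTrigPoly m c) (Ioo (-1) 1) N) :
    ∃ (l : List ℝ) (s : ℝ), l.length ≤ N ∧ (∀ v ∈ l, v ∈ Ioo (-1 : ℝ) 1) ∧ s ≠ 0 ∧
      ∀ u ∈ Icc (-1 : ℝ) 1,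
        0 ≤ s * (chebyshevDensity m c u * ((1 :: -1 :: l).map fun v => u - v).prod) := by
  obtain ⟨l, s, hl, hlI, hs, hsign⟩ := AtMostIsolatedZeros.exists_list_sign ordConnected_Ioo
    (analyticOnNhd_trigPoly _ _ _) h
  -- The sign flips because `(u - 1) (u + 1) = -(1 - u ^ 2)`. These two factors also vanish at the
  -- endpoints, so the masses there may have any sign.
  refine ⟨l, -s, hl, hlI, neg_ne_zero.2 hs, fun u hu => ?_⟩
  rw [List.map_cons, List.map_cons, List.prod_cons, List.prod_cons]
  rcases hu.1.eq_or_lt with rfl | h1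
  · simp
  rcases hu.2.eq_or_lt with rfl | h2
  · simp
  rw [chebyshevDensity, endpointDensity_of_mem ⟨h1, h2⟩]
  have := mul_nonneg (one_sub_sq_pos ⟨h1, h2⟩).le (hsign u ⟨h1, h2⟩)
  change 0 ≤ (1 - u ^ 2) * (s * (chebyshevTrigPoly m c u * _)) at this
  linarith

lemma exists_list_sign_chebyshevDensity_of_coeff {m k : ℕ} (hm : 1 ≤ m) (hk : 2 ≤ k) {c : ℕ → ℝ}
    (hc : ∀ i, k ≤ i → c i = 0) :
    ∃ (l : List ℝ) (s : ℝ), l.length ≤ k - 2 ∧ (∀ v ∈ l, v ∈ Icc (-1 : ℝ) 1) ∧ s ≠ 0 ∧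
      ∀ u ∈ Icc (-1 : ℝ) 1,
        0 ≤ s * (chebyshevDensity m c u * (l.map fun v => u - v).prod) := by
  rcases lt_or_ge k 4 with hk4 | hk4
  · have hg : ∀ u, chebyshevTrigPoly m c u = 0 :=
      chebyshevTrigPoly_eq_zero fun i hi => hc i (by omega)
    rcases hk.eq_or_lt with rfl | hk
    · refine ⟨[], if c 1 = 0 then 1 else c 1, by simp, by simp,
        by split_ifs with h <;> simp [h], fun u _ => ?_⟩
      have h2 : c 2 = 0 := hc 2 le_rfl
      unfold chebyshevDensity endpointDensity
      split_ifs <;> simp_all [mul_self_nonneg]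
    · obtain ⟨s, hs, hsign⟩ := endpointDensity_sign_of_zero (c 1) (c 2) hg
      exact ⟨[1], s, by simp; omega, by simp, hs, fun u _ => by simpa [chebyshevDensity] using hsign u⟩
  · obtain ⟨l, s, hl, hlI, hs, hsign⟩ := exists_list_sign_chebyshevDensity
      (atMostIsolatedZeros_chebyshevTrigPoly hm hk4 hc)
    refine ⟨1 :: -1 :: l, s, by simp; omega, ?_, hs, hsign⟩
    intro v hv
    rcases List.mem_cons.1 hv with rfl | hv
    · norm_num
    rcases List.mem_cons.1 hv with rfl | hv
    · norm_num
    exact Ioo_subset_Icc_self (hlI v hv)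

variable {m : ℕ} {σ ε τ β : ℝ} {J : Set ℝ}

lemma ae_cosMeasure_mem_Icc : ∀ᵐ u ∂cosMeasure, u ∈ Icc (-1 : ℝ) 1 :=
  ae_cosMeasure_of_forall_Icc fun _ hu => hu

lemma abs_eq_one_of_branch (hετ : ε = 1 ∧ τ = 1 ∨ ε = -1 ∧ τ = σ) : |ε| = 1 := by
  rcases hετ with ⟨rfl, _⟩ | ⟨rfl, _⟩ <;> simp

lemma ne_zero_of_branch (hσ : σ = 1 ∨ σ = -1) (hετ : ε = 1 ∧ τ = 1 ∨ ε = -1 ∧ τ = σ) : τ ≠ 0 := by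
  rcases hετ with ⟨_, rfl⟩ | ⟨_, rfl⟩
  · exact one_ne_zero
  · rcases hσ with rfl | rfl <;> norm_num

lemma analyticOnNhd_chebyshevSum (hm : 1 ≤ m) (hετ : ε = 1 ∧ τ = 1 ∨ ε = -1 ∧ τ = σ)
    (hJ : IsOpen J) (hJD : ∀ ρ ∈ J, 1 + ρ ∈ powDomain ε) (c : ℕ → ℝ) :
    AnalyticOnNhd ℝ (chebyshevSum σ β m c) J := by
  intro ρ hρ
  have h1 : AnalyticAt ℝ (fun ρ : ℝ => 1 + ρ) ρ := by fun_prop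
  have h2 := AnalyticAt.fun_comp (g := powTransform ε cosMeasure β (chebyshevDensity m c))
    (analyticAt_powTransform (abs_eq_one_of_branch hετ) ae_cosMeasure_mem_Icc
    (integrable_chebyshevDensity m c) β (hJD ρ hρ)) h1
  refine ((analyticAt_const (v := c 0)).add ((analyticAt_const (v := τ)).mul h2)).congr ?_
  filter_upwards [hJ.mem_nhds hρ] with x hx
  exact (chebyshevSum_eq_powTransform hm hετ β (hJD x hx) c).symm

lemma atMostIsolatedZeros_chebyshevSum (hm : 1 ≤ m) (hσ : σ = 1 ∨ σ = -1)
    (hετ : ε = 1 ∧ τ = 1 ∨ ε = -1 ∧ τ = σ) (hβ : β ≠ 0)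
    (hJ : IsOpen J) (hJc : J.OrdConnected) (hJD : ∀ ρ ∈ J, 1 + ρ ∈ powDomain ε) {k : ℕ}
    (hk : 1 ≤ k) {c : ℕ → ℝ} (hc : ∀ i, k ≤ i → c i = 0) :
    AtMostIsolatedZeros (chebyshevSum σ β m c) J (k - 1) := by
  rcases hk.eq_or_lt with rfl | hk2
  · have h0 : ∀ ρ, chebyshevSum σ β m c ρ = c 0 := fun ρ => by
      rw [chebyshevSum, Finset.sum_eq_single 0 (fun i _ hi => by simp [hc i (by omega)])
        (fun h => absurd (Finset.mem_range.2 (by omega)) h)]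
      simp [chebyshevList]
    refine AtMostIsolatedZeros.of_zero_imp hJ fun x _ hx y _ => ?_
    rw [h0] at hx ⊢
    exact hx
  set h := chebyshevDensity m c with hh
  have hε := abs_eq_one_of_branch hετ
  have hτ := ne_zero_of_branch hσ hετ
  have hε0 : ε ≠ 0 := fun h => by simp [h] at hε
  have hint : Integrable h cosMeasure := integrable_chebyshevDensity m c
  set J' : Set ℝ := (fun x => x - 1) ⁻¹' J with hJ'
  have hJ'o : IsOpen J' := hJ.preimage (by fun_prop)
  have hJ'c : J'.OrdConnected := ⟨fun x hx y hy z hz =>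
    hJc.out hx hy ⟨sub_le_sub_right hz.1 1, sub_le_sub_right hz.2 1⟩⟩
  have hJ'D : J' ⊆ powDomain ε := fun x hx => by simpa using hJD _ hx
  have han : ∀ γ, AnalyticOnNhd ℝ (powTransform ε cosMeasure γ h) J' := fun γ x hx =>
    analyticAt_powTransform hε ae_cosMeasure_mem_Icc hint γ (hJ'D hx)
  have hanH : AnalyticOnNhd ℝ (fun x => c 0 + τ * powTransform ε cosMeasure β h x) J' := fun x hx =>
    analyticAt_const.add (analyticAt_const.mul (han β x hx))
  obtain ⟨l, s, hl, hlI, hs, hsign⟩ := exists_list_sign_chebyshevDensity_of_coeff hm hk2 hc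
  have h1 : AtMostIsolatedZeros (powTransform ε cosMeasure (β - 1) h) J' (k - 2) :=
    (atMostIsolatedZeros_powTransform hε ae_cosMeasure_mem_Icc hJ'o hJ'c hJ'D hs l (β - 1) hlI hint
      (ae_cosMeasure_of_forall_Icc hsign)).mono hl
  -- Rolle once more: differentiating removes `c 0` and leaves a nonzero multiple of the transform
  -- with exponent `β - 1`.
  have h2 : AtMostIsolatedZeros (fun x => c 0 + τ * powTransform ε cosMeasure β h x) J'
      (k - 2 + 1) := by
    refine AtMostIsolatedZeros.of_deriv hJ'c hanH ?_
    refine (h1.mul_left (han _) (g := fun _ => τ * (ε * β)) analyticOnNhd_const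
      fun x _ => by simp [hτ, hε0, hβ]).congr hJ'o fun x hx => ?_
    rw [(((hasDerivAt_powTransform hε ae_cosMeasure_mem_Icc hint β (hJ'D hx)).const_mul
      τ).const_add (c 0)).deriv]
    simp only [Pi.mul_apply]
    ring
  rw [show k - 2 + 1 = k - 1 by omega] at h2
  refine (AtMostIsolatedZeros.comp_const_add 1 hanH h2).congr hJ fun ρ hρ => ?_
  exact (chebyshevSum_eq_powTransform hm hετ β (hJD ρ hρ) c).symm

/-- By continuity the product vanishes everywhere inside, so the trigonometric polynomial is zero
off the finite list. Its cosine and sine parts vanish separately, and `T_j`, `U_j` are independent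
by degree. -/
lemma chebyshevTrigPoly_coeff_eq_zero {c : ℕ → ℝ} {l : List ℝ}
    (h : ∀ᵐ u ∂cosMeasure, chebyshevDensity m c u * (l.map fun v => u - v).prod = 0) :
    ∀ i, 3 ≤ i → i < 4 * m + 2 → c i = 0 := by
  have h1 : ∀ᵐ u ∂((volume.restrict (Ioo 0 Real.pi)).map Real.cos),
      chebyshevDensity m c u * (l.map fun v => u - v).prod = 0 := by
    rw [cosMeasure, ae_add_measure_iff] at h
    exact h.1
  have h2 := ae_of_ae_map (by fun_prop) h1
  have hcont : Continuous fun u => chebyshevTrigPoly m c u * (l.map fun v => u - v).prod :=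
    (continuous_trigPoly _ _ _).mul (continuous_list_prod l fun v _ => by fun_prop)
  have h3 : EqOn (fun θ => chebyshevTrigPoly m c (Real.cos θ) *
      (l.map fun v => Real.cos θ - v).prod) (fun _ => 0) (Ioo 0 Real.pi) := by
    refine MeasureTheory.Measure.eqOn_open_of_ae_eq (μ := volume) ?_ isOpen_Ioo
      (hcont.comp Real.continuous_cos).continuousOn continuousOn_const
    filter_upwards [h2, ae_restrict_mem measurableSet_Ioo] with θ hθ hθ'
    rwa [chebyshevDensity, endpointDensity_of_mem (cos_mem_Ioo hθ')] at hθ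
  have h4 : ∀ u ∈ Ioo (-1 : ℝ) 1 \ {v | v ∈ l}, chebyshevTrigPoly m c u = 0 := by
    intro u hu
    have hθ : Real.arccos u ∈ Ioo 0 Real.pi :=
      ⟨Real.arccos_pos.2 hu.1.2, Real.arccos_lt_pi.2 hu.1.1⟩
    have h5 := h3 hθ
    simp only [Real.cos_arccos hu.1.1.le hu.1.2.le] at h5
    refine (mul_eq_zero.1 h5).resolve_right fun h6 => ?_
    obtain ⟨v, hv, hv'⟩ := List.mem_map.1 (List.prod_eq_zero_iff.1 h6)
    exact hu.2 (by rwa [sub_eq_zero.1 hv'])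
  obtain ⟨hA, hB⟩ := eq_zero_of_trigPoly_eq_zero
    ((Ioo_infinite (by norm_num : (-1 : ℝ) < 1)).sdiff l.finite_toSet) sdiff_subset h4
  have hA' := eq_zero_of_sum_C_mul_eq_zero
    (fun j => by rw [Polynomial.Chebyshev.degree_T]; simp) hA
  have hB' := eq_zero_of_sum_C_mul_eq_zero
    (fun j => Polynomial.Chebyshev.degree_U_natCast (R := ℝ) j) hB
  intro i hi hi'
  rcases lt_or_ge i (3 + 2 * m) with him | him
  · have := hA' (i - 3) (by omega)
    rwa [show 3 + (i - 3) = i by omega] at this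
  · have := hB' (2 * m - 1 - 1 - (i - (3 + 2 * m))) (by omega)
    rwa [show 3 + 2 * m + (2 * m - 1 - 1 - (2 * m - 1 - 1 - (i - (3 + 2 * m)))) = i by omega] at this

lemma coeff_eq_zero_of_chebyshevSum_eq_zero (hm : 1 ≤ m) (hσ : σ = 1 ∨ σ = -1)
    (hετ : ε = 1 ∧ τ = 1 ∨ ε = -1 ∧ τ = σ) (hβ : ∀ n : ℕ, β ≠ n)
    (hJ : IsOpen J) (hJne : J.Nonempty) (hJD : ∀ ρ ∈ J, 1 + ρ ∈ powDomain ε)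
    {c : ℕ → ℝ} (hc : ∀ i, 4 * m + 2 ≤ i → c i = 0)
    (h0 : ∀ ρ ∈ J, chebyshevSum σ β m c ρ = 0) : ∀ i, c i = 0 := by
  set h := chebyshevDensity m c with hh
  have hε := abs_eq_one_of_branch hετ
  have hτ := ne_zero_of_branch hσ hετ
  have hε0 : ε ≠ 0 := fun h => by simp [h] at hε
  have hβ0 : β ≠ 0 := by simpa using hβ 0
  have hint : Integrable h cosMeasure := integrable_chebyshevDensity m c
  set J' : Set ℝ := (fun x => x - 1) ⁻¹' J with hJ'
  have hJ'o : IsOpen J' := hJ.preimage (by fun_prop)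
  have hJ'ne : J'.Nonempty := by
    obtain ⟨ρ, hρ⟩ := hJne
    exact ⟨ρ + 1, by simpa [hJ'] using hρ⟩
  have hJ'D : J' ⊆ powDomain ε := fun x hx => by simpa using hJD _ hx
  have hH : ∀ x ∈ J', c 0 + τ * powTransform ε cosMeasure β h x = 0 := fun x hx => by
    have := chebyshevSum_eq_powTransform hm hετ β (hJD _ hx) c
    rw [h0 _ hx] at this
    simpa using this.symm
  have hG : ∀ x ∈ J', powTransform ε cosMeasure (β - 1) h x = 0 := by
    intro x hx
    have h1 := ((hasDerivAt_powTransform hε ae_cosMeasure_mem_Icc hint β (hJ'D hx)).const_mul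
      τ).const_add (c 0)
    have h2 : (fun x => c 0 + τ * powTransform ε cosMeasure β h x) =ᶠ[𝓝 x] fun _ => 0 := by
      filter_upwards [hJ'o.mem_nhds hx] with y hy using hH y hy
    have h3 := h1.unique ((hasDerivAt_const x (0 : ℝ)).congr_of_eventuallyEq h2)
    simpa [hτ, hε0, hβ0] using h3
  have hae : ∀ (l : List ℝ) (s : ℝ), s ≠ 0 → (∀ v ∈ l, v ∈ Icc (-1 : ℝ) 1) →
      (∀ u ∈ Icc (-1 : ℝ) 1, 0 ≤ s * (h u * (l.map fun v => u - v).prod)) →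
      ∀ᵐ u ∂cosMeasure, h u * (l.map fun v => u - v).prod = 0 := fun l s hs hl hsign =>
    prod_mul_ae_eq_zero_of_powTransform_eqOn_zero hε ae_cosMeasure_mem_Icc hJ'o hJ'ne hJ'D hs l
      (β - 1) (fun n hn => hβ (n + 1) (by push_cast; linarith)) hl hint
      (ae_cosMeasure_of_forall_Icc hsign) hG
  -- The sign list used here contains `±1`, so it says nothing about the masses `c 1` and `c 2`;
  -- shorter lists recover them below.
  have htrig : ∀ i, 3 ≤ i → c i = 0 := by
    intro i hi
    rcases lt_or_ge i (4 * m + 2) with him | him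
    · obtain ⟨l, s, _, hlI, hs, hsign⟩ :=
        exists_list_sign_chebyshevDensity_of_coeff hm (by omega) hc
      exact chebyshevTrigPoly_coeff_eq_zero (hae l s hs hlI hsign) i hi him
    · exact hc i him
  have hc2 : c 2 = 0 := by
    obtain ⟨s, hs, hsign⟩ := endpointDensity_sign_of_zero (c 1) (c 2)
      (chebyshevTrigPoly_eq_zero (m := m) htrig)
    -- The list `[1]` keeps the mass at `-1` visible.
    have h1 := hae [1] s hs (by simp) fun u _ => by simpa [hh, chebyshevDensity] using hsign u
    simp only [cosMeasure, ae_add_measure_iff, ae_dirac_eq, eventually_pure] at h1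
    have h2 := h1.2.2
    simp only [hh, chebyshevDensity, endpointDensity_neg_one] at h2
    norm_num at h2
    exact h2
  have hc1 : c 1 = 0 := by
    obtain ⟨l, s, hl, hlI, hs, hsign⟩ := exists_list_sign_chebyshevDensity_of_coeff hm le_rfl
      (c := c) fun i hi => by
        rcases hi.eq_or_lt with rfl | hi
        · exact hc2
        · exact htrig i hi
    obtain rfl : l = [] := by simpa using hl
    have h1 := hae [] s hs hlI hsign
    -- With the empty list, the mass at `1` is visible as well.
    simp only [cosMeasure, ae_add_measure_iff, ae_dirac_eq, eventually_pure] at h1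
    simpa [hh, chebyshevDensity] using h1.2.1
  have hc0 : c 0 = 0 := by
    obtain ⟨ρ, hρ⟩ := hJne
    have h1 := h0 ρ hρ
    rw [chebyshevSum, Finset.sum_eq_single 0 (fun i _ hi => ?_)
        (fun h => absurd (Finset.mem_range.2 (by omega)) h)] at h1
    · simpa [chebyshevList] using h1
    · have : c i = 0 := by
        rcases (by omega : i = 1 ∨ i = 2 ∨ 3 ≤ i) with rfl | rfl | hi
        exacts [hc1, hc2, htrig i hi]
      simp [this]
  intro i
  rcases (by omega : i = 0 ∨ i = 1 ∨ i = 2 ∨ 3 ≤ i) with rfl | rfl | rfl | hi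
  exacts [hc0, hc1, hc2, htrig i hi]

/-- An interval meeting both components would contain `-1`, which lies in neither. -/
lemma exists_branch_of_subset_annulusParams {p : ℤ} (hJc : J.OrdConnected) (hJne : J.Nonempty)
    (hJI : J ⊆ annulusParams p) (σ : ℝ) :
    ∃ ε τ : ℝ, (ε = 1 ∧ τ = 1 ∨ ε = -1 ∧ τ = σ) ∧ ∀ ρ ∈ J, 1 + ρ ∈ powDomain ε := by
  have hsub : J ⊆ Iio (-2) ∪ Ioi 0 := by
    refine hJI.trans ?_
    unfold annulusParams
    split_ifs
    exacts [subset_rfl, subset_union_left, subset_union_right]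
  obtain ⟨a, ha⟩ := hJne
  rcases hsub ha with ha' | ha'
  · refine ⟨-1, σ, Or.inr ⟨rfl, rfl⟩, fun ρ hρ u hu => ?_⟩
    have hlt : ρ < -2 := by
      refine (hsub hρ).resolve_right fun h0 => ?_
      have ha2 : a < -2 := ha'
      have h02 : 0 < ρ := h0
      have : (-1 : ℝ) ∈ J := hJc.out ha hρ ⟨by linarith, by linarith⟩
      rcases hsub this with h | h <;> norm_num at h
    linarith [hu.1]
  · refine ⟨1, 1, Or.inl ⟨rfl, rfl⟩, fun ρ hρ u hu => ?_⟩
    have hlt : 0 < ρ := by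
      refine (hsub hρ).resolve_left fun h0 => ?_
      have ha2 : 0 < a := ha'
      have h02 : ρ < -2 := h0
      have : (-1 : ℝ) ∈ J := hJc.out hρ ha ⟨by linarith, by linarith⟩
      rcases hsub this with h | h <;> norm_num at h
    linarith [hu.2]

end

theorem proposition3p7 (p : ℤ) (hp : p ≠ 1) (m : ℕ) (hm : 1 ≤ m)
    (σ : ℝ) (hσ : σ = 1 ∨ σ = -1)
    (β : ℝ) (hβ : β ≠ 0 ∧ β ≠ 1 ∧ β ≠ 2)
    (J : Set ℝ) (hJ : IsOpen J) (hJc : J.OrdConnected) (hJne : J.Nonempty)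
    (hJI : J ⊆ annulusParams p) :
    IsECTSystem (chebyshevList σ β m).get J ∧
      ((∀ j : ℕ, β ≠ j) →
        LinearIndependent ℝ (fun i (ρ : J) => (chebyshevList σ β m).get i ρ)) := by
  obtain ⟨ε, τ, hετ, hJD⟩ := exists_branch_of_subset_annulusParams hJc hJne hJI σ
  have hlen := length_chebyshevList σ β hm
  refine ⟨⟨fun i => ?_, fun k hk hkn a _ => ?_⟩, fun hβn => ?_⟩
  · have hi : (i : ℕ) < 4 * m + 2 := hlen ▸ i.2
    have h := analyticOnNhd_chebyshevSum (β := β) hm hετ hJ hJD (Pi.single (i : ℕ) 1)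
    have heq : chebyshevSum σ β m (Pi.single (i : ℕ) 1) = (chebyshevList σ β m).get i := by
      ext ρ
      rw [chebyshevSum, Finset.sum_eq_single (i : ℕ)
        (fun j _ hj => by simp [Pi.single_eq_of_ne hj])
        (fun h => absurd (Finset.mem_range.2 hi) h), List.getD_eq_getElem _ _ i.2]
      simp
    rwa [heq] at h
  · rw [funext fun x => sum_fin_mul_get σ β hm hkn a x]
    exact atMostIsolatedZeros_chebyshevSum hm hσ hετ hβ.1 hJ hJc hJD hk fun i hi => by
      simp [hi.not_gt]
  · rw [Fintype.linearIndependent_iff]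
    intro g hg i
    have h := coeff_eq_zero_of_chebyshevSum_eq_zero hm hσ hετ hβn hJ hJne hJD
      (c := fun i => if h : i < (chebyshevList σ β m).length then g ⟨i, h⟩ else 0)
      (fun i hi => by simp [hlen, hi.not_gt])
      (fun ρ hρ => by
        rw [← sum_fin_mul_get σ β hm le_rfl g ρ]
        have := congrFun hg ⟨ρ, hρ⟩
        simpa [Finset.sum_apply] using this) i
    simpa using h
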